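/- Let $m\ge 2$. Let $a$ be a smooth Riemannian metric and $b$ a smooth nowhere vanishing $1$-form on the sphere $\mathbb S^{2m-1}$, and let $$F(x,y)=\frac{\alpha^2}{\beta}=\frac{a_{ij}(x)y^iy^j}{b_i(x)y^i}$$ be the associated Kropina metric, a conic Finsler metric on the conic domain $A=\{(x,y)\in T\mathbb S^{2m-1} : b_i(x)y^i>0\}$. (Equivalently, $F(x,y)=h(y,y)/(2h(W,y))$ for a Riemannian metric $h$ and a vector field $W$ with $h(W,W)=1$.) Suppose that $F$ has constant flag curvature $K>0$, i.e. $$\frac{R_{hijk}\,y^hX^iy^jX^k}{(g_{hj}g_{ik}-g_{hk}g_{ij})\,y^hX^iy^jX^k}=K$$ for all $x$ and all linearly independent $y,X\in A_x$, where $g_{ij}$ is the Hessian of $\tfrac12F^2$ in $y$ and $R_{hijk}=g_{ir}R_h{}^r{}_{jk}$ is the Berwald $h$-curvature of $F$. Then $F$ is not projectively flat: $\mathbb S^{2m-1}$ cannot be covered by coordinate neighbourhoods in each of which the extremals of the length functional $\int F(c,\dot c)\,dt$ (as point sets) are exactly the straight line segments with direction in $A$. -/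

import Mathlib

open Set MeasureTheory
open scoped Manifold ContDiff

noncomputable section

namespace KropinaSpace

/-! ### Conic Finsler geometry in local coordinates

In a chart, a conic Finsler metric is a function `L x y` of the position `x` and of the tangent
vector `y`, considered for `(x, y)` in an open set of `ℝⁿ × ℝⁿ`.
The index `i` of a coordinate runs over `Fin n`. -/

section Local

variable {n : ℕ}

/-- The partial derivative `∂f/∂xᵏ`. -/
def dX (k : Fin n) (f : EuclideanSpace ℝ (Fin n) → EuclideanSpace ℝ (Fin n) → ℝ) :
    EuclideanSpace ℝ (Fin n) → EuclideanSpace ℝ (Fin n) → ℝ :=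
  fun x y => fderiv ℝ (fun x' => f x' y) x (EuclideanSpace.single k 1)

/-- The partial derivative `∂f/∂yᵏ`. -/
def dY (k : Fin n) (f : EuclideanSpace ℝ (Fin n) → EuclideanSpace ℝ (Fin n) → ℝ) :
    EuclideanSpace ℝ (Fin n) → EuclideanSpace ℝ (Fin n) → ℝ :=
  fun x y => fderiv ℝ (fun y' => f x y') y (EuclideanSpace.single k 1)

variable (L : EuclideanSpace ℝ (Fin n) → EuclideanSpace ℝ (Fin n) → ℝ)

/-- The fundamental tensor `g_{ij}`, the Hessian of `L² / 2` in the variable `y`. -/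
def fundTensor (i j : Fin n) : EuclideanSpace ℝ (Fin n) → EuclideanSpace ℝ (Fin n) → ℝ :=
  dY i (dY j (fun x y => L x y ^ 2 / 2))

/-- The inverse fundamental tensor `g^{ij}`. -/
def fundTensorInv (i j : Fin n) : EuclideanSpace ℝ (Fin n) → EuclideanSpace ℝ (Fin n) → ℝ :=
  fun x y => (Matrix.of fun p q => fundTensor L p q x y)⁻¹ i j

/-- The Christoffel symbols of the second kind
`γⁱ_{jk} = ½ g^{is} (∂g_{sj}/∂xᵏ - ∂g_{jk}/∂xˢ + ∂g_{ks}/∂xʲ)`. -/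
def christoffel (i j k : Fin n) : EuclideanSpace ℝ (Fin n) → EuclideanSpace ℝ (Fin n) → ℝ :=
  fun x y => 1 / 2 * ∑ s, fundTensorInv L i s x y *
    (dX k (fundTensor L s j) x y - dX s (fundTensor L j k) x y + dX j (fundTensor L k s) x y)

/-- The spray coefficients `Gⁱ = ½ γⁱ_{jk} yʲ yᵏ`. -/
def spray (i : Fin n) : EuclideanSpace ℝ (Fin n) → EuclideanSpace ℝ (Fin n) → ℝ :=
  fun x y => 1 / 2 * ∑ j, ∑ k, christoffel L i j k x y * y j * y k

/-- The coefficients `Nⁱ_j = ∂Gⁱ/∂yʲ` of the nonlinear connection. -/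
def nonlinConn (i j : Fin n) : EuclideanSpace ℝ (Fin n) → EuclideanSpace ℝ (Fin n) → ℝ :=
  dY j (spray L i)

/-- The coefficients `Γⁱ_{jk} = ∂Nⁱ_j/∂yᵏ` of the Berwald connection. -/
def berwald (i j k : Fin n) : EuclideanSpace ℝ (Fin n) → EuclideanSpace ℝ (Fin n) → ℝ :=
  dY k (nonlinConn L i j)

/-- The horizontal derivative `δf/δxˡ = ∂f/∂xˡ - Nʳ_l ∂f/∂yʳ`. -/
def horDeriv (l : Fin n) (f : EuclideanSpace ℝ (Fin n) → EuclideanSpace ℝ (Fin n) → ℝ) :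
    EuclideanSpace ℝ (Fin n) → EuclideanSpace ℝ (Fin n) → ℝ :=
  fun x y => dX l f x y - ∑ r, nonlinConn L r l x y * dY r f x y

/-- The Berwald `h`-curvature
`R_jⁱ_{kl} = δΓⁱ_{jk}/δxˡ + Γʳ_{jk} Γⁱ_{rl} - (k ↔ l)`. -/
def curvature (j i k l : Fin n) : EuclideanSpace ℝ (Fin n) → EuclideanSpace ℝ (Fin n) → ℝ :=
  fun x y =>
    (horDeriv L l (berwald L i j k) x y + ∑ r, berwald L r j k x y * berwald L i r l x y) -
    (horDeriv L k (berwald L i j l) x y + ∑ r, berwald L r j l x y * berwald L i r k x y)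

/-- The curvature with lowered index, `R_{hijk} = g_{ir} R_hʳ_{jk}`. -/
def curvatureLow (h i j k : Fin n) : EuclideanSpace ℝ (Fin n) → EuclideanSpace ℝ (Fin n) → ℝ :=
  fun x y => ∑ r, fundTensor L i r x y * curvature L h r j k x y

/-- The flag curvature `K(x, y, X)`, that is
`R_{hijk} yʰ Xⁱ yʲ Xᵏ / ((g_{hj} g_{ik} - g_{hk} g_{ij}) yʰ Xⁱ yʲ Xᵏ)`.
It is meaningful when `y` and `X` are linearly independent. -/
def flagCurvature (x y X : EuclideanSpace ℝ (Fin n)) : ℝ :=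
  (∑ h, ∑ i, ∑ j, ∑ k, curvatureLow L h i j k x y * y h * X i * y j * X k) /
  (∑ h, ∑ i, ∑ j, ∑ k,
    (fundTensor L h j x y * fundTensor L i k x y - fundTensor L h k x y * fundTensor L i j x y) *
      y h * X i * y j * X k)

/-- The smooth curve `c`, restricted to `[a, b]`, is admissible: its position and velocity stay in
the domain `D` of the metric. -/
def IsAdmissible (D : Set (EuclideanSpace ℝ (Fin n) × EuclideanSpace ℝ (Fin n)))
    (c : ℝ → EuclideanSpace ℝ (Fin n)) (a b : ℝ) : Prop :=
  ContDiff ℝ ∞ c ∧ ∀ t ∈ Icc a b, (c t, deriv c t) ∈ D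

/-- The curve `c`, restricted to `[a, b]`, is an extremal: it is a critical point of the length
functional `∫ L(c, c') dt` among smooth variations with fixed end points. -/
def IsExtremal (c : ℝ → EuclideanSpace ℝ (Fin n)) (a b : ℝ) : Prop :=
  ∀ φ : ℝ → EuclideanSpace ℝ (Fin n), ContDiff ℝ ∞ φ → φ a = 0 → φ b = 0 →
    HasDerivAt
      (fun s : ℝ => ∫ t in a..b, L (c t + s • φ t) (deriv c t + s • deriv φ t)) 0 0

/-- The coordinates are rectilinear: as point sets, the extremals are exactly the admissible
pieces of straight lines. -/
def HasRectilinearExtremals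
    (D : Set (EuclideanSpace ℝ (Fin n) × EuclideanSpace ℝ (Fin n))) : Prop :=
  ∀ (c : ℝ → EuclideanSpace ℝ (Fin n)) (a b : ℝ), a < b → IsAdmissible D c a b →
    (IsExtremal L c a b ↔ Collinear ℝ (c '' Icc a b))

end Local

/-! ### Conic Finsler spaces

A conic Finsler metric on `M` is a function `F` on an open conic set `A` of the tangent bundle;
`F` is represented by a function on `TM` whose values outside `A` are irrelevant. -/

section Global

variable {n : ℕ} {M : Type*} [TopologicalSpace M] [ChartedSpace (EuclideanSpace ℝ (Fin n)) M]
  [IsManifold (𝓡 n) ∞ M]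

/-- The expression of `F` in the chart `e`: `(x, y)` stands for the vector `yⁱ ∂/∂xⁱ` at the point
with coordinates `x`. -/
def inChart (F : TangentBundle (𝓡 n) M → ℝ)
    (e : OpenPartialHomeomorph M (EuclideanSpace ℝ (Fin n))) :
    EuclideanSpace ℝ (Fin n) → EuclideanSpace ℝ (Fin n) → ℝ :=
  fun x y => F (tangentMap 𝓘(ℝ, EuclideanSpace ℝ (Fin n)) (𝓡 n) e.symm ⟨x, y⟩)

/-- The expression of the conic domain `A` in the chart `e`. -/
def domainInChart (A : Set (TangentBundle (𝓡 n) M))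
    (e : OpenPartialHomeomorph M (EuclideanSpace ℝ (Fin n))) :
    Set (EuclideanSpace ℝ (Fin n) × EuclideanSpace ℝ (Fin n)) :=
  {p | p.1 ∈ e.target ∧
    tangentMap 𝓘(ℝ, EuclideanSpace ℝ (Fin n)) (𝓡 n) e.symm ⟨p.1, p.2⟩ ∈ A}

/-- `(A, F)` has constant flag curvature `K`: in all local coordinates, `K(x, y, X) = K` for all
linearly independent `y` and `X` in the conic domain over `x`. -/
def HasConstantFlagCurvature (A : Set (TangentBundle (𝓡 n) M))
    (F : TangentBundle (𝓡 n) M → ℝ) (K : ℝ) : Prop :=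
  ∀ e ∈ IsManifold.maximalAtlas (𝓡 n) ∞ M, ∀ x y X : EuclideanSpace ℝ (Fin n),
    (x, y) ∈ domainInChart A e → (x, X) ∈ domainInChart A e → LinearIndependent ℝ ![y, X] →
    flagCurvature (inChart F e) x y X = K

/-- `(A, F)` is projectively flat: it is with rectilinear extremals, that is, `M` is covered by
coordinate neighbourhoods in which the extremals of `F` are the admissible straight lines. -/
def IsProjectivelyFlat (A : Set (TangentBundle (𝓡 n) M))
    (F : TangentBundle (𝓡 n) M → ℝ) : Prop :=
  ∀ p : M, ∃ e ∈ IsManifold.maximalAtlas (𝓡 n) ∞ M, p ∈ e.source ∧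
    HasRectilinearExtremals (inChart F e) (domainInChart A e)

end Global

/-- The data of a globally defined Kropina space on `M`: a smooth Riemannian metric `a` and a smooth
nowhere vanishing `1`-form `b`.  (Smoothness of a `1`-form means smoothness of the function
`β = b_i(x) yⁱ` on the tangent bundle.) -/
structure KropinaData (n : ℕ) (M : Type*) [TopologicalSpace M]
    [ChartedSpace (EuclideanSpace ℝ (Fin n)) M] [IsManifold (𝓡 n) ∞ M] where
  /-- the Riemannian metric -/
  a : Bundle.ContMDiffRiemannianMetric (𝓡 n) ∞ (EuclideanSpace ℝ (Fin n))
    (fun x : M => TangentSpace (𝓡 n) x)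
  /-- the `1`-form -/
  b : ∀ x : M, TangentSpace (𝓡 n) x →L[ℝ] ℝ
  smooth_b : ContMDiff (𝓡 n).tangent 𝓘(ℝ, ℝ) ∞
    (fun v : TangentBundle (𝓡 n) M => b v.proj v.snd)
  b_ne_zero : ∀ x : M, b x ≠ 0

namespace KropinaData

variable {n : ℕ} {M : Type*} [TopologicalSpace M] [ChartedSpace (EuclideanSpace ℝ (Fin n)) M]
  [IsManifold (𝓡 n) ∞ M]

/-- The conic domain `A = {β > 0}` of the Kropina metric. -/
def domain (κ : KropinaData n M) : Set (TangentBundle (𝓡 n) M) :=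
  {v | 0 < κ.b v.proj v.snd}

/-- The Kropina metric `F = α² / β`. -/
def metric (κ : KropinaData n M) : TangentBundle (𝓡 n) M → ℝ :=
  fun v => κ.a.inner v.proj v.snd v.snd / κ.b v.proj v.snd

end KropinaData

end KropinaSpace

end

/-!
The statement is local, and holds in every dimension at least two: already one chart with
rectilinear extremals excludes constant flag curvature `K > 0`.

In such a chart, vanishing of the first variation of length along straight segments yields Hamel's
equations `∂L/∂xˡ = yᵏ ∂²L/∂xᵏ∂yˡ` (`hamelOn_of_hasRectilinearExtremals`).  They say that the spray
is `Gⁱ = P yⁱ` with `P = yᵏ ∂ₖL / (2L)` (`spray_eq_coord_mul_projFactor`), so that up to terms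
proportional to `yⁱ` the contracted curvature is `(P² - P') δⁱ_k`, where a prime denotes the
derivative `yᵏ ∂/∂xᵏ` along straight lines (`exists_sum_sum_curvature_eq`).  On a flag whose
transverse edge is `g_y`-orthogonal to `y` the extra terms drop out, and `K L² = P² - P'`
(`flagCurvature_mul_sq`).  This uses that the fundamental tensor is invertible; for a Kropina
metric it is positive definite (`IsKropinaPair.fundTensor_pos`).

Substituting `L = A / β` with `A = a(y, y)` and clearing denominators gives
`3 (A'β - Aβ')² - 2A (A''β² - 2A'ββ' + 2Aβ'² - Aββ'') = 4 K A⁴`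
(`IsKropinaPair.flagCurvature_identity`).  Both sides are continuous in `y`, so the identity
persists at a vector `y ≠ 0` with `β(y) = 0`, on the boundary of the conic domain, where it reads
`-A² β'² = 4 K A⁴`.  Since `A > 0`, this is impossible for `K > 0`
(`IsKropinaPair.false_of_flagCurvature_eq`).
-/

noncomputable section

/-! ### Partial derivatives of jointly smooth functions -/

namespace KropinaSpace

section Calculus

variable {n : ℕ}

/-- The function `f x y` of position and direction is smooth in both variables on `D`. -/
def JointlySmoothOn (D : Set (EuclideanSpace ℝ (Fin n) × EuclideanSpace ℝ (Fin n)))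
    (f : EuclideanSpace ℝ (Fin n) → EuclideanSpace ℝ (Fin n) → ℝ) : Prop :=
  ContDiffOn ℝ ∞ (fun p : EuclideanSpace ℝ (Fin n) × EuclideanSpace ℝ (Fin n) => f p.1 p.2) D

variable {D : Set (EuclideanSpace ℝ (Fin n) × EuclideanSpace ℝ (Fin n))}
  {f g : EuclideanSpace ℝ (Fin n) → EuclideanSpace ℝ (Fin n) → ℝ}
  {x y : EuclideanSpace ℝ (Fin n)}

lemma JointlySmoothOn.contDiffAt (hf : JointlySmoothOn D f) (hD : IsOpen D) (hp : (x, y) ∈ D) :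
    ContDiffAt ℝ ∞ (fun p : EuclideanSpace ℝ (Fin n) × EuclideanSpace ℝ (Fin n) => f p.1 p.2)
      (x, y) :=
  ContDiffOn.contDiffAt hf (hD.mem_nhds hp)

lemma JointlySmoothOn.hasFDerivAt (hf : JointlySmoothOn D f) (hD : IsOpen D) (hp : (x, y) ∈ D) :
    HasFDerivAt (fun p : EuclideanSpace ℝ (Fin n) × EuclideanSpace ℝ (Fin n) => f p.1 p.2)
      (fderiv ℝ (fun p : EuclideanSpace ℝ (Fin n) × EuclideanSpace ℝ (Fin n) => f p.1 p.2) (x, y))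
      (x, y) :=
  ((hf.contDiffAt hD hp).differentiableAt (by simp)).hasFDerivAt

lemma JointlySmoothOn.hasFDerivAt_fst (hf : JointlySmoothOn D f) (hD : IsOpen D)
    (hp : (x, y) ∈ D) :
    HasFDerivAt (fun x' => f x' y)
      ((fderiv ℝ (fun p : EuclideanSpace ℝ (Fin n) × EuclideanSpace ℝ (Fin n) => f p.1 p.2)
        (x, y)).comp (ContinuousLinearMap.inl ℝ _ _)) x :=
  HasFDerivAt.comp (g := fun p : EuclideanSpace ℝ (Fin n) × EuclideanSpace ℝ (Fin n) => f p.1 p.2)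
    (f := fun x' => (x', y)) x (hf.hasFDerivAt hD hp) (hasFDerivAt_prodMk_left x y)

lemma JointlySmoothOn.hasFDerivAt_snd (hf : JointlySmoothOn D f) (hD : IsOpen D)
    (hp : (x, y) ∈ D) :
    HasFDerivAt (fun y' => f x y')
      ((fderiv ℝ (fun p : EuclideanSpace ℝ (Fin n) × EuclideanSpace ℝ (Fin n) => f p.1 p.2)
        (x, y)).comp (ContinuousLinearMap.inr ℝ _ _)) y :=
  HasFDerivAt.comp (g := fun p : EuclideanSpace ℝ (Fin n) × EuclideanSpace ℝ (Fin n) => f p.1 p.2)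
    (f := fun y' => (x, y')) y (hf.hasFDerivAt hD hp) (hasFDerivAt_prodMk_right x y)

lemma JointlySmoothOn.dX_eq (hf : JointlySmoothOn D f) (hD : IsOpen D) (hp : (x, y) ∈ D)
    (k : Fin n) :
    dX k f x y = fderiv ℝ
      (fun p : EuclideanSpace ℝ (Fin n) × EuclideanSpace ℝ (Fin n) => f p.1 p.2) (x, y)
      (EuclideanSpace.single k 1, 0) := by
  simp [dX, (hf.hasFDerivAt_fst hD hp).fderiv]

lemma JointlySmoothOn.dY_eq (hf : JointlySmoothOn D f) (hD : IsOpen D) (hp : (x, y) ∈ D)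
    (k : Fin n) :
    dY k f x y = fderiv ℝ
      (fun p : EuclideanSpace ℝ (Fin n) × EuclideanSpace ℝ (Fin n) => f p.1 p.2) (x, y)
      (0, EuclideanSpace.single k 1) := by
  simp [dY, (hf.hasFDerivAt_snd hD hp).fderiv]

lemma contDiffOn_fderiv_apply (hD : IsOpen D) (hf : JointlySmoothOn D f)
    (u : EuclideanSpace ℝ (Fin n) × EuclideanSpace ℝ (Fin n)) :
    ContDiffOn ℝ ∞ (fun p => fderiv ℝ
      (fun p : EuclideanSpace ℝ (Fin n) × EuclideanSpace ℝ (Fin n) => f p.1 p.2) p u) D :=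
  (ContDiffOn.fderiv_of_isOpen hf hD (by simp)).clm_apply contDiffOn_const

lemma JointlySmoothOn.dX (hf : JointlySmoothOn D f) (hD : IsOpen D) (k : Fin n) :
    JointlySmoothOn D (dX k f) :=
  (contDiffOn_fderiv_apply hD hf (EuclideanSpace.single k 1, 0)).congr
    fun _ hp => hf.dX_eq hD hp k

lemma JointlySmoothOn.dY (hf : JointlySmoothOn D f) (hD : IsOpen D) (k : Fin n) :
    JointlySmoothOn D (dY k f) :=
  (contDiffOn_fderiv_apply hD hf (0, EuclideanSpace.single k 1)).congr
    fun _ hp => hf.dY_eq hD hp k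

lemma JointlySmoothOn.mul (hf : JointlySmoothOn D f) (hg : JointlySmoothOn D g) :
    JointlySmoothOn D (fun x y => f x y * g x y) :=
  ContDiffOn.mul hf hg

lemma JointlySmoothOn.add (hf : JointlySmoothOn D f) (hg : JointlySmoothOn D g) :
    JointlySmoothOn D (fun x y => f x y + g x y) :=
  ContDiffOn.add hf hg

lemma JointlySmoothOn.sum {ι : Type*} {s : Finset ι}
    {f : ι → EuclideanSpace ℝ (Fin n) → EuclideanSpace ℝ (Fin n) → ℝ}
    (hf : ∀ i ∈ s, JointlySmoothOn D (f i)) : JointlySmoothOn D (fun x y => ∑ i ∈ s, f i x y) :=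
  ContDiffOn.sum hf

lemma jointlySmoothOn_const (c : ℝ) : JointlySmoothOn D (fun _ _ => c) :=
  contDiffOn_const

lemma jointlySmoothOn_coord (i : Fin n) : JointlySmoothOn D (fun _ y => y i) := by
  unfold JointlySmoothOn
  fun_prop

lemma JointlySmoothOn.congr (hf : JointlySmoothOn D f)
    (hfg : ∀ x y, (x, y) ∈ D → f x y = g x y) : JointlySmoothOn D g :=
  ContDiffOn.congr hf fun p hp => (hfg p.1 p.2 hp).symm

lemma JointlySmoothOn.mono {D' : Set (EuclideanSpace ℝ (Fin n) × EuclideanSpace ℝ (Fin n))}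
    (hf : JointlySmoothOn D f) (h : D' ⊆ D) : JointlySmoothOn D' f :=
  ContDiffOn.mono hf h

lemma dX_congr (hD : IsOpen D) (hfg : ∀ x y, (x, y) ∈ D → f x y = g x y) (hp : (x, y) ∈ D)
    (k : Fin n) : dX k f x y = dX k g x y := by
  unfold dX
  congr 1
  apply Filter.EventuallyEq.fderiv_eq
  filter_upwards [(hD.preimage (Continuous.prodMk_left y)).mem_nhds hp] with x' hx'
  exact hfg x' y hx'

lemma dY_congr (hD : IsOpen D) (hfg : ∀ x y, (x, y) ∈ D → f x y = g x y) (hp : (x, y) ∈ D)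
    (k : Fin n) : dY k f x y = dY k g x y := by
  unfold dY
  congr 1
  apply Filter.EventuallyEq.fderiv_eq
  filter_upwards [(hD.preimage (Continuous.prodMk_right x)).mem_nhds hp] with y' hy'
  exact hfg x y' hy'

lemma dX_add (hD : IsOpen D) (hf : JointlySmoothOn D f) (hg : JointlySmoothOn D g)
    (hp : (x, y) ∈ D) (k : Fin n) :
    dX k (fun x y => f x y + g x y) x y = dX k f x y + dX k g x y := by
  unfold dX
  rw [fderiv_fun_add (hf.hasFDerivAt_fst hD hp).differentiableAt
    (hg.hasFDerivAt_fst hD hp).differentiableAt]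
  simp

lemma dY_add (hD : IsOpen D) (hf : JointlySmoothOn D f) (hg : JointlySmoothOn D g)
    (hp : (x, y) ∈ D) (k : Fin n) :
    dY k (fun x y => f x y + g x y) x y = dY k f x y + dY k g x y := by
  unfold dY
  rw [fderiv_fun_add (hf.hasFDerivAt_snd hD hp).differentiableAt
    (hg.hasFDerivAt_snd hD hp).differentiableAt]
  simp

lemma dX_mul (hD : IsOpen D) (hf : JointlySmoothOn D f) (hg : JointlySmoothOn D g)
    (hp : (x, y) ∈ D) (k : Fin n) :
    dX k (fun x y => f x y * g x y) x y = dX k f x y * g x y + f x y * dX k g x y := by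
  unfold dX
  rw [fderiv_fun_mul (hf.hasFDerivAt_fst hD hp).differentiableAt
    (hg.hasFDerivAt_fst hD hp).differentiableAt]
  simp
  ring

lemma dY_mul (hD : IsOpen D) (hf : JointlySmoothOn D f) (hg : JointlySmoothOn D g)
    (hp : (x, y) ∈ D) (k : Fin n) :
    dY k (fun x y => f x y * g x y) x y = dY k f x y * g x y + f x y * dY k g x y := by
  unfold dY
  rw [fderiv_fun_mul (hf.hasFDerivAt_snd hD hp).differentiableAt
    (hg.hasFDerivAt_snd hD hp).differentiableAt]
  simp
  ring

lemma dX_sum (hD : IsOpen D) {ι : Type*} {s : Finset ι}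
    {f : ι → EuclideanSpace ℝ (Fin n) → EuclideanSpace ℝ (Fin n) → ℝ}
    (hf : ∀ i ∈ s, JointlySmoothOn D (f i)) (hp : (x, y) ∈ D) (k : Fin n) :
    dX k (fun x y => ∑ i ∈ s, f i x y) x y = ∑ i ∈ s, dX k (f i) x y := by
  unfold dX
  rw [fderiv_fun_sum fun i hi => ((hf i hi).hasFDerivAt_fst hD hp).differentiableAt]
  simp

lemma dY_sum (hD : IsOpen D) {ι : Type*} {s : Finset ι}
    {f : ι → EuclideanSpace ℝ (Fin n) → EuclideanSpace ℝ (Fin n) → ℝ}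
    (hf : ∀ i ∈ s, JointlySmoothOn D (f i)) (hp : (x, y) ∈ D) (k : Fin n) :
    dY k (fun x y => ∑ i ∈ s, f i x y) x y = ∑ i ∈ s, dY k (f i) x y := by
  unfold dY
  rw [fderiv_fun_sum fun i hi => ((hf i hi).hasFDerivAt_snd hD hp).differentiableAt]
  simp

@[simp] lemma dX_const (c : ℝ) (k : Fin n) : dX k (fun _ _ => c) x y = 0 := by
  simp [dX]

@[simp] lemma dY_const (c : ℝ) (k : Fin n) : dY k (fun _ _ => c) x y = 0 := by
  simp [dY]

@[simp] lemma dX_snd (h : EuclideanSpace ℝ (Fin n) → ℝ) (k : Fin n) :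
    dX k (fun _ y => h y) x y = 0 := by
  simp [dX]

lemma dY_coord (i k : Fin n) :
    dY k (fun _ y => y i) x y = if i = k then 1 else 0 := by
  have : HasFDerivAt (fun y' : EuclideanSpace ℝ (Fin n) => y' i)
      (EuclideanSpace.proj i : EuclideanSpace ℝ (Fin n) →L[ℝ] ℝ) y :=
    (EuclideanSpace.proj i : EuclideanSpace ℝ (Fin n) →L[ℝ] ℝ).hasFDerivAt
  simp [dY, this.fderiv]

lemma dX_const_mul (hD : IsOpen D) (hf : JointlySmoothOn D f) (hp : (x, y) ∈ D) (c : ℝ)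
    (k : Fin n) : dX k (fun x y => c * f x y) x y = c * dX k f x y := by
  rw [dX_mul hD (jointlySmoothOn_const c) hf hp]
  simp

lemma dY_const_mul (hD : IsOpen D) (hf : JointlySmoothOn D f) (hp : (x, y) ∈ D) (c : ℝ)
    (k : Fin n) : dY k (fun x y => c * f x y) x y = c * dY k f x y := by
  rw [dY_mul hD (jointlySmoothOn_const c) hf hp]
  simp

lemma dX_sum_coord_mul (hD : IsOpen D)
    {f : Fin n → EuclideanSpace ℝ (Fin n) → EuclideanSpace ℝ (Fin n) → ℝ}
    (hf : ∀ j, JointlySmoothOn D (f j)) (hp : (x, y) ∈ D) (k : Fin n) :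
    dX k (fun x y => ∑ j, y j * f j x y) x y = ∑ j, y j * dX k (f j) x y := by
  rw [dX_sum hD (fun j _ => (jointlySmoothOn_coord j).mul (hf j)) hp]
  refine Finset.sum_congr rfl fun j _ => ?_
  rw [dX_mul hD (jointlySmoothOn_coord j) (hf j) hp, dX_snd (fun y => y j)]
  ring

lemma dY_sum_coord_mul (hD : IsOpen D)
    {f : Fin n → EuclideanSpace ℝ (Fin n) → EuclideanSpace ℝ (Fin n) → ℝ}
    (hf : ∀ j, JointlySmoothOn D (f j)) (hp : (x, y) ∈ D) (k : Fin n) :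
    dY k (fun x y => ∑ j, y j * f j x y) x y = f k x y + ∑ j, y j * dY k (f j) x y := by
  rw [dY_sum hD (fun j _ => (jointlySmoothOn_coord j).mul (hf j)) hp]
  simp only [dY_mul hD (jointlySmoothOn_coord _) (hf _) hp, dY_coord]
  simp [Finset.sum_add_distrib]

/-- Mixed second partial derivatives in two directions of the total space commute. -/
lemma fderiv_fderiv_comm (hD : IsOpen D) (hf : JointlySmoothOn D f) (hp : (x, y) ∈ D)
    (u v : EuclideanSpace ℝ (Fin n) × EuclideanSpace ℝ (Fin n)) :
    fderiv ℝ (fun p => fderiv ℝ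
      (fun p : EuclideanSpace ℝ (Fin n) × EuclideanSpace ℝ (Fin n) => f p.1 p.2) p u) (x, y) v =
    fderiv ℝ (fun p => fderiv ℝ
      (fun p : EuclideanSpace ℝ (Fin n) × EuclideanSpace ℝ (Fin n) => f p.1 p.2) p v) (x, y) u := by
  have hd : DifferentiableAt ℝ (fderiv ℝ
      (fun p : EuclideanSpace ℝ (Fin n) × EuclideanSpace ℝ (Fin n) => f p.1 p.2)) (x, y) :=
    ((ContDiffOn.fderiv_of_isOpen hf hD (m := ∞) (by simp)).contDiffAt
      (hD.mem_nhds hp)).differentiableAt (by simp)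
  have hs := (hf.contDiffAt hD hp).isSymmSndFDerivAt
    (by simpa using ENat.LEInfty.out)
  rw [fderiv_clm_apply hd (differentiableAt_const u), fderiv_clm_apply hd (differentiableAt_const v)]
  simpa using hs.eq v u

lemma JointlySmoothOn.fderiv_congr_dX (hf : JointlySmoothOn D f) (hD : IsOpen D)
    (hp : (x, y) ∈ D) (k : Fin n) :
    fderiv ℝ (fun p : EuclideanSpace ℝ (Fin n) × EuclideanSpace ℝ (Fin n) =>
      KropinaSpace.dX k f p.1 p.2) (x, y) =
    fderiv ℝ (fun p => fderiv ℝ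
      (fun p : EuclideanSpace ℝ (Fin n) × EuclideanSpace ℝ (Fin n) => f p.1 p.2) p
        (EuclideanSpace.single k 1, 0)) (x, y) := by
  apply Filter.EventuallyEq.fderiv_eq
  filter_upwards [hD.mem_nhds hp] with p hp'
  exact hf.dX_eq hD hp' k

lemma JointlySmoothOn.fderiv_congr_dY (hf : JointlySmoothOn D f) (hD : IsOpen D)
    (hp : (x, y) ∈ D) (k : Fin n) :
    fderiv ℝ (fun p : EuclideanSpace ℝ (Fin n) × EuclideanSpace ℝ (Fin n) =>
      KropinaSpace.dY k f p.1 p.2) (x, y) =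
    fderiv ℝ (fun p => fderiv ℝ
      (fun p : EuclideanSpace ℝ (Fin n) × EuclideanSpace ℝ (Fin n) => f p.1 p.2) p
        (0, EuclideanSpace.single k 1)) (x, y) := by
  apply Filter.EventuallyEq.fderiv_eq
  filter_upwards [hD.mem_nhds hp] with p hp'
  exact hf.dY_eq hD hp' k

lemma dX_dY_comm (hD : IsOpen D) (hf : JointlySmoothOn D f) (hp : (x, y) ∈ D) (j k : Fin n) :
    dX j (dY k f) x y = dY k (dX j f) x y := by
  rw [(hf.dY hD k).dX_eq hD hp, (hf.dX hD j).dY_eq hD hp, hf.fderiv_congr_dX hD hp,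
    hf.fderiv_congr_dY hD hp, fderiv_fderiv_comm hD hf hp]

lemma dY_dY_comm (hD : IsOpen D) (hf : JointlySmoothOn D f) (hp : (x, y) ∈ D) (j k : Fin n) :
    dY j (dY k f) x y = dY k (dY j f) x y := by
  rw [(hf.dY hD k).dY_eq hD hp, (hf.dY hD j).dY_eq hD hp, hf.fderiv_congr_dY hD hp,
    hf.fderiv_congr_dY hD hp, fderiv_fderiv_comm hD hf hp]

lemma euclidean_eq_sum (v : EuclideanSpace ℝ (Fin n)) :
    v = ∑ k, v k • EuclideanSpace.single k (1 : ℝ) := by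
  ext i
  simp [Finset.sum_apply, Pi.single_apply]

/-- The derivative of `f` along the spray of straight lines, `yᵏ ∂f/∂xᵏ`. -/
def lineDerivX (f : EuclideanSpace ℝ (Fin n) → EuclideanSpace ℝ (Fin n) → ℝ) :
    EuclideanSpace ℝ (Fin n) → EuclideanSpace ℝ (Fin n) → ℝ :=
  fun x y => ∑ k, y k * dX k f x y

/-- The derivative `vᵏ ∂f/∂yᵏ` of `f` in the constant vertical direction `v`. -/
def dirY (v : EuclideanSpace ℝ (Fin n))
    (f : EuclideanSpace ℝ (Fin n) → EuclideanSpace ℝ (Fin n) → ℝ) :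
    EuclideanSpace ℝ (Fin n) → EuclideanSpace ℝ (Fin n) → ℝ :=
  fun x y => ∑ k, v k * dY k f x y

lemma dirY_eq_fderiv (v : EuclideanSpace ℝ (Fin n))
    (f : EuclideanSpace ℝ (Fin n) → EuclideanSpace ℝ (Fin n) → ℝ) :
    dirY v f x y = fderiv ℝ (fun y' => f x y') y v := by
  conv_rhs => rw [euclidean_eq_sum v]
  simp [dirY, dY]

lemma JointlySmoothOn.lineDerivX_eq (hf : JointlySmoothOn D f) (hD : IsOpen D)
    (hp : (x, y) ∈ D) :
    lineDerivX f x y = fderiv ℝ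
      (fun p : EuclideanSpace ℝ (Fin n) × EuclideanSpace ℝ (Fin n) => f p.1 p.2) (x, y) (y, 0) := by
  have : fderiv ℝ (fun x' => f x' y) x y = fderiv ℝ
      (fun p : EuclideanSpace ℝ (Fin n) × EuclideanSpace ℝ (Fin n) => f p.1 p.2) (x, y) (y, 0) := by
    simp [(hf.hasFDerivAt_fst hD hp).fderiv]
  rw [← this]
  conv_rhs => enter [2]; rw [euclidean_eq_sum y]
  simp [lineDerivX, KropinaSpace.dX]

lemma JointlySmoothOn.lineDerivX (hf : JointlySmoothOn D f) (hD : IsOpen D) :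
    JointlySmoothOn D (lineDerivX f) :=
  JointlySmoothOn.sum fun k _ => (jointlySmoothOn_coord k).mul (hf.dX hD k)

lemma JointlySmoothOn.dirY (hf : JointlySmoothOn D f) (hD : IsOpen D)
    (v : EuclideanSpace ℝ (Fin n)) : JointlySmoothOn D (dirY v f) :=
  JointlySmoothOn.sum fun k _ => (jointlySmoothOn_const (v k)).mul (hf.dY hD k)

lemma lineDerivX_congr (hD : IsOpen D) (hfg : ∀ x y, (x, y) ∈ D → f x y = g x y)
    (hp : (x, y) ∈ D) : lineDerivX f x y = lineDerivX g x y := by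
  simp only [lineDerivX, dX_congr hD hfg hp]

lemma dirY_congr (hD : IsOpen D) (hfg : ∀ x y, (x, y) ∈ D → f x y = g x y)
    (hp : (x, y) ∈ D) (v : EuclideanSpace ℝ (Fin n)) : dirY v f x y = dirY v g x y := by
  simp only [dirY, dY_congr hD hfg hp]

lemma lineDerivX_mul (hD : IsOpen D) (hf : JointlySmoothOn D f) (hg : JointlySmoothOn D g)
    (hp : (x, y) ∈ D) :
    lineDerivX (fun x y => f x y * g x y) x y =
      lineDerivX f x y * g x y + f x y * lineDerivX g x y := by
  simp only [lineDerivX, dX_mul hD hf hg hp, Finset.sum_mul, Finset.mul_sum,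
    ← Finset.sum_add_distrib]
  exact Finset.sum_congr rfl fun _ _ => by ring

lemma lineDerivX_add (hD : IsOpen D) (hf : JointlySmoothOn D f) (hg : JointlySmoothOn D g)
    (hp : (x, y) ∈ D) :
    lineDerivX (fun x y => f x y + g x y) x y = lineDerivX f x y + lineDerivX g x y := by
  simp only [lineDerivX, dX_add hD hf hg hp, mul_add, Finset.sum_add_distrib]

lemma dirY_add (hD : IsOpen D) (hf : JointlySmoothOn D f) (hg : JointlySmoothOn D g)
    (hp : (x, y) ∈ D) (v : EuclideanSpace ℝ (Fin n)) :
    dirY v (fun x y => f x y + g x y) x y = dirY v f x y + dirY v g x y := by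
  simp only [dirY, dY_add hD hf hg hp, mul_add, Finset.sum_add_distrib]

lemma dirY_mul (hD : IsOpen D) (hf : JointlySmoothOn D f) (hg : JointlySmoothOn D g)
    (hp : (x, y) ∈ D) (v : EuclideanSpace ℝ (Fin n)) :
    dirY v (fun x y => f x y * g x y) x y = dirY v f x y * g x y + f x y * dirY v g x y := by
  simp only [dirY, dY_mul hD hf hg hp, Finset.sum_mul, Finset.mul_sum,
    ← Finset.sum_add_distrib]
  exact Finset.sum_congr rfl fun _ _ => by ring

end Calculus

end KropinaSpace

/-! ### Curvature of a spray -/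

namespace KropinaSpace

section Spray

variable {n : ℕ} {D : Set (EuclideanSpace ℝ (Fin n) × EuclideanSpace ℝ (Fin n))}
  {f : EuclideanSpace ℝ (Fin n) → EuclideanSpace ℝ (Fin n) → ℝ}
  {L : EuclideanSpace ℝ (Fin n) → EuclideanSpace ℝ (Fin n) → ℝ}
  {x y : EuclideanSpace ℝ (Fin n)}

/-- Positive homogeneity of degree `r` in the variable `y`, expressed by Euler's relation. -/
def IsHomogeneousOn (D : Set (EuclideanSpace ℝ (Fin n) × EuclideanSpace ℝ (Fin n))) (r : ℝ)
    (f : EuclideanSpace ℝ (Fin n) → EuclideanSpace ℝ (Fin n) → ℝ) : Prop :=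
  ∀ x y, (x, y) ∈ D → ∑ j, y j * dY j f x y = r * f x y

lemma IsHomogeneousOn.dY {r : ℝ} (hr : IsHomogeneousOn D r f) (hD : IsOpen D)
    (hf : JointlySmoothOn D f) (k : Fin n) : IsHomogeneousOn D (r - 1) (dY k f) := by
  intro x y hp
  have h := dY_congr hD hr hp k
  rw [dY_sum_coord_mul hD (fun j => hf.dY hD j) hp, dY_const_mul hD hf hp] at h
  simp only [fun j => dY_dY_comm hD hf hp j k]
  linarith

/-- Contraction of the Berwald `h`-curvature with `yʰ yʲ`, in terms of the spray alone. -/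
lemma sum_sum_curvature (hD : IsOpen D) (hG : ∀ i, JointlySmoothOn D (spray L i))
    (hhom : ∀ i, IsHomogeneousOn D 2 (spray L i)) (hp : (x, y) ∈ D) (i k : Fin n) :
    ∑ h, ∑ j, curvature L h i j k x y * y h * y j =
      2 * dX k (spray L i) x y + 2 * ∑ r, spray L r x y * berwald L i r k x y -
        lineDerivX (nonlinConn L i k) x y -
        ∑ r, nonlinConn L r k x y * nonlinConn L i r x y := by
  have hN : ∀ i j, JointlySmoothOn D (nonlinConn L i j) := fun i j => (hG i).dY hD j
  have hΓ : ∀ i j k, JointlySmoothOn D (berwald L i j k) := fun i j k => (hN i j).dY hD k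
  have hN1 : ∀ i j, IsHomogeneousOn D 1 (nonlinConn L i j) := fun i j => by
    have := (hhom i).dY hD (hG i) j
    norm_num at this
    exact this
  have hsymm : ∀ i j k x y, (x, y) ∈ D → berwald L i j k x y = berwald L i k j x y :=
    fun i j k x y hp => dY_dY_comm hD (hG i) hp k j
  have hΓy : ∀ i h x y, (x, y) ∈ D → ∑ j, y j * berwald L i h j x y = nonlinConn L i h x y :=
    fun i h x y hp => (hN1 i h x y hp).trans (one_mul _)
  have hΓy' : ∀ i k x y, (x, y) ∈ D → ∑ h, y h * berwald L i h k x y = nonlinConn L i k x y :=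
    fun i k x y hp => by simp only [hsymm _ _ k x y hp, hΓy _ _ x y hp]
  have hNy : ∀ i x y, (x, y) ∈ D → ∑ h, y h * nonlinConn L i h x y = 2 * spray L i x y := hhom
  have hΓ0 : ∀ i h r, ∑ j, y j * dY r (berwald L i h j) x y = 0 := fun i h r => by
    have := (hN1 i h).dY hD (hN i h) r x y hp
    simp only [berwald, fun j => dY_dY_comm hD (hN i h) hp r j]
    simpa using this
  have hΓ0' : ∀ i k r, ∑ h, y h * dY r (berwald L i h k) x y = 0 := fun i k r => by
    simp only [fun h => dY_congr hD (hsymm i h k) hp r, hΓ0]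
  have hT1 : ∑ h, ∑ j, horDeriv L k (berwald L i h j) x y * y h * y j =
      2 * dX k (spray L i) x y := by
    rw [← dX_const_mul hD (hG i) hp, ← dX_congr hD (hNy i) hp,
      dX_sum_coord_mul hD (hN i) hp]
    refine Finset.sum_congr rfl fun h _ => ?_
    rw [← dX_congr hD (hΓy i h) hp, dX_sum_coord_mul hD (hΓ i h) hp]
    have h0 : ∑ j, y j * ∑ r, nonlinConn L r k x y * dY r (berwald L i h j) x y = 0 := by
      simp only [Finset.mul_sum]
      rw [Finset.sum_comm]
      simp only [mul_left_comm (y _)]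
      simp only [← Finset.mul_sum, hΓ0, mul_zero, Finset.sum_const_zero]
    calc _ = y h * (∑ j, y j * dX k (berwald L i h j) x y -
          ∑ j, y j * ∑ r, nonlinConn L r k x y * dY r (berwald L i h j) x y) := by
            rw [← Finset.sum_sub_distrib, Finset.mul_sum]
            exact Finset.sum_congr rfl fun j _ => by simp only [horDeriv]; ring
      _ = _ := by rw [h0, sub_zero]
  have hT2 : ∑ h, ∑ j, (∑ r, berwald L r h j x y * berwald L i r k x y) * y h * y j =
      2 * ∑ r, spray L r x y * berwald L i r k x y := by
    calc _ = ∑ r, (∑ h, y h * ∑ j, y j * berwald L r h j x y) * berwald L i r k x y := by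
            simp only [Finset.sum_mul, Finset.mul_sum]
            rw [Finset.sum_congr rfl fun h _ => Finset.sum_comm, Finset.sum_comm]
            exact Finset.sum_congr rfl fun r _ => Finset.sum_congr rfl fun h _ =>
              Finset.sum_congr rfl fun j _ => by ring
      _ = _ := by
            simp only [hΓy _ _ x y hp, hNy _ x y hp, Finset.mul_sum]
            exact Finset.sum_congr rfl fun r _ => by ring
  have hT3 : ∑ h, ∑ j, horDeriv L j (berwald L i h k) x y * y h * y j =
      lineDerivX (nonlinConn L i k) x y := by
    rw [Finset.sum_comm, lineDerivX]
    refine Finset.sum_congr rfl fun j _ => ?_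
    rw [← dX_congr hD (hΓy' i k) hp, dX_sum_coord_mul hD (fun h => hΓ i h k) hp]
    have h0 : ∑ h, y h * ∑ r, nonlinConn L r j x y * dY r (berwald L i h k) x y = 0 := by
      simp only [Finset.mul_sum]
      rw [Finset.sum_comm]
      simp only [mul_left_comm (y _)]
      simp only [← Finset.mul_sum, hΓ0', mul_zero, Finset.sum_const_zero]
    calc _ = y j * (∑ h, y h * dX j (berwald L i h k) x y -
          ∑ h, y h * ∑ r, nonlinConn L r j x y * dY r (berwald L i h k) x y) := by
            rw [← Finset.sum_sub_distrib, Finset.mul_sum]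
            exact Finset.sum_congr rfl fun h _ => by simp only [horDeriv]; ring
      _ = _ := by rw [h0, sub_zero]
  have hT4 : ∑ h, ∑ j, (∑ r, berwald L r h k x y * berwald L i r j x y) * y h * y j =
      ∑ r, nonlinConn L r k x y * nonlinConn L i r x y := by
    calc _ = ∑ r, (∑ h, y h * berwald L r h k x y) * ∑ j, y j * berwald L i r j x y := by
            simp only [Finset.sum_mul, Finset.mul_sum]
            rw [Finset.sum_congr rfl fun h _ => Finset.sum_comm, Finset.sum_comm]
            refine Finset.sum_congr rfl fun r _ => ?_
            rw [Finset.sum_comm]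
            exact Finset.sum_congr rfl fun h _ => Finset.sum_congr rfl fun j _ => by ring
      _ = _ := by simp only [hΓy _ _ x y hp, hΓy' _ _ x y hp]
  rw [← hT1, ← hT2, ← hT3, ← hT4]
  simp only [← Finset.sum_add_distrib, ← Finset.sum_sub_distrib]
  exact Finset.sum_congr rfl fun h _ => Finset.sum_congr rfl fun j _ => by
    simp only [curvature]
    ring

/-- If the spray is `Gⁱ = P yⁱ`, the contracted curvature is a multiple of the identity up to a
tensor with values in the line spanned by `y`. -/
lemma exists_sum_sum_curvature_eq {P : EuclideanSpace ℝ (Fin n) → EuclideanSpace ℝ (Fin n) → ℝ}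
    (hD : IsOpen D) (hP : JointlySmoothOn D P) (hP1 : IsHomogeneousOn D 1 P)
    (hG : ∀ i x y, (x, y) ∈ D → spray L i x y = y i * P x y) (hp : (x, y) ∈ D) :
    ∃ τ : Fin n → ℝ, ∀ i k, ∑ h, ∑ j, curvature L h i j k x y * y h * y j =
      (P x y ^ 2 - lineDerivX P x y) * (if i = k then 1 else 0) + τ k * y i := by
  have hGs : ∀ i, JointlySmoothOn D (spray L i) := fun i =>
    ((jointlySmoothOn_coord i).mul hP).congr fun x y hp => (hG i x y hp).symm
  have hN : ∀ i j x y, (x, y) ∈ D →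
      nonlinConn L i j x y = (if i = j then 1 else 0) * P x y + y i * dY j P x y := by
    intro i j x y hp
    rw [nonlinConn, dY_congr hD (hG i) hp, dY_mul hD (jointlySmoothOn_coord i) hP hp, dY_coord]
  have hhom : ∀ i, IsHomogeneousOn D 2 (spray L i) := by
    intro i x y hp
    have h1 := hP1 x y hp
    change ∑ j, y j * nonlinConn L i j x y = _
    simp only [hN i _ x y hp, hG i x y hp, mul_add, Finset.sum_add_distrib]
    simp only [mul_left_comm (y _) (y i), ← Finset.mul_sum, h1]
    simp
    ring
  have hsymm : ∀ i j k, berwald L i j k x y = berwald L i k j x y :=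
    fun i j k => dY_dY_comm hD (hGs i) hp k j
  have hΓ : ∀ i k, ∑ r, y r * berwald L i r k x y = nonlinConn L i k x y := fun i k => by
    have := (hhom i).dY hD (hGs i) k x y hp
    norm_num at this
    simp only [hsymm i _ k]
    exact this
  refine ⟨fun k => 2 * dX k P x y - P x y * dY k P x y - lineDerivX (dY k P) x y, fun i k => ?_⟩
  rw [sum_sum_curvature hD hGs hhom hp, dX_congr hD (hG i) hp,
    dX_mul hD (jointlySmoothOn_coord i) hP hp, dX_snd (fun y => y i)]
  have h2 : ∑ r, spray L r x y * berwald L i r k x y = P x y * nonlinConn L i k x y := by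
    rw [← hΓ, Finset.mul_sum]
    exact Finset.sum_congr rfl fun r _ => by rw [hG r x y hp]; ring
  have h3 : lineDerivX (nonlinConn L i k) x y =
      (if i = k then 1 else 0) * lineDerivX P x y + y i * lineDerivX (dY k P) x y := by
    rw [lineDerivX_congr hD (hN i k) hp, lineDerivX_add hD ((jointlySmoothOn_const _).mul hP)
      ((jointlySmoothOn_coord i).mul (hP.dY hD k)) hp,
      lineDerivX_mul hD (jointlySmoothOn_const _) hP hp,
      lineDerivX_mul hD (jointlySmoothOn_coord i) (hP.dY hD k) hp]
    simp [lineDerivX, dX_snd (fun y => y i)]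
  have h4 : ∑ r, nonlinConn L r k x y * nonlinConn L i r x y =
      P x y * nonlinConn L i k x y + dY k P x y * (2 * (y i * P x y)) := by
    have h : ∑ r, y r * nonlinConn L i r x y = 2 * (y i * P x y) := by
      rw [← hG i x y hp]
      exact hhom i x y hp
    rw [← h]
    simp only [hN _ k x y hp, add_mul, Finset.sum_add_distrib, Finset.mul_sum]
    congr 1
    · simp [hN i k x y hp]
    · exact Finset.sum_congr rfl fun r _ => by ring
  rw [h2, h3, h4, hN i k x y hp]
  ring

end Spray

end KropinaSpace

/-! ### Metrics satisfying Hamel's equations -/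

namespace KropinaSpace

section Hamel

variable {n : ℕ} {D : Set (EuclideanSpace ℝ (Fin n) × EuclideanSpace ℝ (Fin n))}
  {L : EuclideanSpace ℝ (Fin n) → EuclideanSpace ℝ (Fin n) → ℝ}
  {x y X : EuclideanSpace ℝ (Fin n)}

/-- The projective factor `P = yᵏ ∂ₖL / (2 L)` of a metric with rectilinear extremals. -/
def projFactor (L : EuclideanSpace ℝ (Fin n) → EuclideanSpace ℝ (Fin n) → ℝ) :
    EuclideanSpace ℝ (Fin n) → EuclideanSpace ℝ (Fin n) → ℝ :=
  fun x y => lineDerivX L x y / (2 * L x y)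

/-- Hamel's equations `∂L/∂xˡ = yᵏ ∂²L/∂xᵏ∂yˡ`. -/
def HamelOn (D : Set (EuclideanSpace ℝ (Fin n) × EuclideanSpace ℝ (Fin n)))
    (L : EuclideanSpace ℝ (Fin n) → EuclideanSpace ℝ (Fin n) → ℝ) : Prop :=
  ∀ l x y, (x, y) ∈ D → dX l L x y = lineDerivX (dY l L) x y

lemma jointlySmoothOn_projFactor (hD : IsOpen D) (hL : JointlySmoothOn D L)
    (hL0 : ∀ x y, (x, y) ∈ D → 0 < L x y) : JointlySmoothOn D (projFactor L) :=
  ContDiffOn.div (hL.lineDerivX hD) ((jointlySmoothOn_const 2).mul hL)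
    fun p hp => by have := hL0 p.1 p.2 hp; positivity

lemma two_mul_mul_projFactor (hL0 : ∀ x y, (x, y) ∈ D → 0 < L x y) (hp : (x, y) ∈ D) :
    2 * L x y * projFactor L x y = lineDerivX L x y := by
  have := (hL0 x y hp).ne'
  unfold projFactor
  field_simp

lemma isHomogeneousOn_projFactor (hD : IsOpen D) (hL : JointlySmoothOn D L)
    (hL0 : ∀ x y, (x, y) ∈ D → 0 < L x y) (hL1 : IsHomogeneousOn D 1 L) (hH : HamelOn D L) :
    IsHomogeneousOn D 1 (projFactor L) := by
  intro x y hp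
  have hP := jointlySmoothOn_projFactor hD hL hL0
  have hj : ∀ j, 2 * (dY j L x y * projFactor L x y + L x y * dY j (projFactor L) x y) =
      2 * dX j L x y := by
    intro j
    have h := dY_congr hD (fun x y hp => two_mul_mul_projFactor hL0 hp) hp j
    simp only [mul_assoc] at h
    rw [dY_const_mul hD (hL.mul hP) hp, dY_mul hD hL hP hp] at h
    unfold lineDerivX at h
    rw [dY_sum_coord_mul hD (fun k => hL.dX hD k) hp] at h
    simp only [← fun k => dX_dY_comm hD hL hp k j] at h
    have h' := hH j x y hp
    unfold lineDerivX at h'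
    linarith
  have hsum : ∑ j, y j * (dY j L x y * projFactor L x y + L x y * dY j (projFactor L) x y) =
      lineDerivX L x y := by
    unfold lineDerivX
    exact Finset.sum_congr rfl fun j _ => by rw [mul_left_cancel₀ two_ne_zero (hj j)]
  have hsplit : ∑ j, y j * (dY j L x y * projFactor L x y + L x y * dY j (projFactor L) x y) =
      (∑ j, y j * dY j L x y) * projFactor L x y +
        L x y * ∑ j, y j * dY j (projFactor L) x y := by
    rw [Finset.sum_mul, Finset.mul_sum, ← Finset.sum_add_distrib]
    exact Finset.sum_congr rfl fun j _ => by ring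
  rw [hsplit, hL1 x y hp, ← two_mul_mul_projFactor hL0 hp] at hsum
  have := (hL0 x y hp).ne'
  apply mul_left_cancel₀ this
  linarith

lemma jointlySmoothOn_energy (hL : JointlySmoothOn D L) :
    JointlySmoothOn D (fun x y => L x y ^ 2 / 2) :=
  ((jointlySmoothOn_const (1 / 2)).mul (hL.mul hL)).congr fun _ _ _ => by ring

lemma dX_energy (hD : IsOpen D) (hL : JointlySmoothOn D L) (hp : (x, y) ∈ D) (k : Fin n) :
    dX k (fun x y => L x y ^ 2 / 2) x y = L x y * dX k L x y := by
  rw [dX_congr hD (g := fun x y => (1 / 2) * (L x y * L x y)) (fun _ _ _ => by ring) hp,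
    dX_const_mul hD (hL.mul hL) hp, dX_mul hD hL hL hp]
  ring

lemma dY_energy (hD : IsOpen D) (hL : JointlySmoothOn D L) (hp : (x, y) ∈ D) (k : Fin n) :
    dY k (fun x y => L x y ^ 2 / 2) x y = L x y * dY k L x y := by
  rw [dY_congr hD (g := fun x y => (1 / 2) * (L x y * L x y)) (fun _ _ _ => by ring) hp,
    dY_const_mul hD (hL.mul hL) hp, dY_mul hD hL hL hp]
  ring

lemma isHomogeneousOn_energy (hD : IsOpen D) (hL : JointlySmoothOn D L)
    (hL1 : IsHomogeneousOn D 1 L) : IsHomogeneousOn D 2 (fun x y => L x y ^ 2 / 2) := by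
  intro x y hp
  simp only [dY_energy hD hL hp, mul_left_comm (y _), ← Finset.mul_sum, hL1 x y hp]
  ring

lemma fundTensor_symm (hD : IsOpen D) (hL : JointlySmoothOn D L) (hp : (x, y) ∈ D)
    (i j : Fin n) : fundTensor L i j x y = fundTensor L j i x y :=
  dY_dY_comm hD (jointlySmoothOn_energy hL) hp i j

lemma jointlySmoothOn_fundTensor (hD : IsOpen D) (hL : JointlySmoothOn D L) (i j : Fin n) :
    JointlySmoothOn D (fundTensor L i j) :=
  ((jointlySmoothOn_energy hL).dY hD j).dY hD i

/-- `g_{ij} yʲ = ∂(L²/2)/∂yⁱ`. -/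
lemma sum_coord_mul_fundTensor (hD : IsOpen D) (hL : JointlySmoothOn D L)
    (hL1 : IsHomogeneousOn D 1 L) (hp : (x, y) ∈ D) (i : Fin n) :
    ∑ j, y j * fundTensor L i j x y = dY i (fun x y => L x y ^ 2 / 2) x y := by
  have h := (isHomogeneousOn_energy hD hL hL1).dY hD (jointlySmoothOn_energy hL) i x y hp
  norm_num at h
  simp only [fundTensor_symm hD hL hp i]
  exact h

/-- Hamel's equations say that the spray is `Gⁱ = P yⁱ`. -/
lemma spray_eq_coord_mul_projFactor (hD : IsOpen D) (hL : JointlySmoothOn D L)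
    (hL0 : ∀ x y, (x, y) ∈ D → 0 < L x y) (hL1 : IsHomogeneousOn D 1 L) (hH : HamelOn D L)
    (hp : (x, y) ∈ D) (hdet : IsUnit (Matrix.of fun p q => fundTensor L p q x y).det)
    (i : Fin n) : spray L i x y = y i * projFactor L x y := by
  have hE := jointlySmoothOn_energy hL
  have hg := jointlySmoothOn_fundTensor hD hL
  have hgy := fun s => fun x y hp => sum_coord_mul_fundTensor (x := x) (y := y) hD hL hL1 hp s
  have hT : ∀ s, ∑ j, ∑ k, dX k (fundTensor L s j) x y * y j * y k =
      lineDerivX (dY s (fun x y => L x y ^ 2 / 2)) x y := by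
    intro s
    rw [Finset.sum_comm, lineDerivX]
    refine Finset.sum_congr rfl fun k _ => ?_
    rw [← dX_congr hD (hgy s) hp, dX_sum_coord_mul hD (hg s) hp, Finset.mul_sum]
    exact Finset.sum_congr rfl fun j _ => by ring
  have hT' : ∀ s, ∑ j, ∑ k, dX j (fundTensor L k s) x y * y j * y k =
      lineDerivX (dY s (fun x y => L x y ^ 2 / 2)) x y := by
    intro s
    rw [← hT s, Finset.sum_comm]
    refine Finset.sum_congr rfl fun j _ => Finset.sum_congr rfl fun k _ => ?_
    rw [dX_congr hD (fun x y hp => fundTensor_symm hD hL hp j s) hp]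
    ring
  have hT2 : ∀ s, ∑ j, ∑ k, dX s (fundTensor L j k) x y * y j * y k =
      2 * dX s (fun x y => L x y ^ 2 / 2) x y := by
    intro s
    rw [← dX_const_mul hD hE hp, ← dX_congr hD (isHomogeneousOn_energy hD hL hL1) hp,
      dX_sum_coord_mul hD (fun j => hE.dY hD j) hp]
    refine Finset.sum_congr rfl fun j _ => ?_
    rw [← dX_congr hD (hgy j) hp, dX_sum_coord_mul hD (hg j) hp, Finset.mul_sum]
    exact Finset.sum_congr rfl fun j _ => by ring
  have hv : ∀ s, ∑ j, ∑ k, (dX k (fundTensor L s j) x y - dX s (fundTensor L j k) x y +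
      dX j (fundTensor L k s) x y) * y j * y k =
      4 * projFactor L x y * ∑ j, fundTensor L s j x y * y j := by
    intro s
    simp only [add_mul, sub_mul, Finset.sum_add_distrib, Finset.sum_sub_distrib, hT, hT', hT2]
    simp only [mul_comm _ (y _), hgy s x y hp]
    rw [lineDerivX_congr hD (fun x y hp => dY_energy hD hL hp s) hp,
      lineDerivX_mul hD hL (hL.dY hD s) hp, ← hH s x y hp, dX_energy hD hL hp,
      dY_energy hD hL hp, ← two_mul_mul_projFactor hL0 hp]
    ring
  have hinv : ∑ s, fundTensorInv L i s x y * ∑ j, fundTensor L s j x y * y j = y i := by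
    have h := congrArg (fun M => M.mulVec (fun j => y j) i) (Matrix.nonsing_inv_mul _ hdet)
    simp only [← Matrix.mulVec_mulVec, Matrix.one_mulVec] at h
    exact h
  calc spray L i x y = 1 / 4 * ∑ s, fundTensorInv L i s x y *
        ∑ j, ∑ k, (dX k (fundTensor L s j) x y - dX s (fundTensor L j k) x y +
          dX j (fundTensor L k s) x y) * y j * y k := by
        simp only [spray, christoffel, Finset.mul_sum, Finset.sum_mul]
        rw [Finset.sum_congr rfl fun j _ => Finset.sum_comm, Finset.sum_comm]
        exact Finset.sum_congr rfl fun s _ => Finset.sum_congr rfl fun j _ =>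
          Finset.sum_congr rfl fun k _ => by ring
    _ = projFactor L x y * ∑ s, fundTensorInv L i s x y * ∑ j, fundTensor L s j x y * y j := by
        simp only [hv, Finset.mul_sum]
        exact Finset.sum_congr rfl fun s _ => Finset.sum_congr rfl fun j _ => by ring
    _ = _ := by rw [hinv, mul_comm]

/-- The flag curvature of a metric satisfying Hamel's equations, along a flag whose transverse edge
`X` is `g_y`-orthogonal to `y`. -/
lemma flagCurvature_mul_sq (hD : IsOpen D) (hL : JointlySmoothOn D L)
    (hL0 : ∀ x y, (x, y) ∈ D → 0 < L x y) (hL1 : IsHomogeneousOn D 1 L) (hH : HamelOn D L)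
    (hdet : ∀ x y, (x, y) ∈ D → IsUnit (Matrix.of fun p q => fundTensor L p q x y).det)
    (hp : (x, y) ∈ D) (hX : dirY X L x y = 0)
    (hXX : ∑ i, ∑ j, fundTensor L i j x y * X i * X j ≠ 0) :
    flagCurvature L x y X * L x y ^ 2 =
      projFactor L x y ^ 2 - lineDerivX (projFactor L) x y := by
  obtain ⟨τ, hτ⟩ := exists_sum_sum_curvature_eq hD (jointlySmoothOn_projFactor hD hL hL0)
    (isHomogeneousOn_projFactor hD hL hL0 hL1 hH)
    (fun i x y hp => spray_eq_coord_mul_projFactor hD hL hL0 hL1 hH hp (hdet x y hp) i) hp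
  set lam := projFactor L x y ^ 2 - lineDerivX (projFactor L) x y
  have hgy := fun s => sum_coord_mul_fundTensor (x := x) (y := y) hD hL hL1 hp s
  have hXy : ∑ i, ∑ j, fundTensor L i j x y * X i * y j = 0 := by
    calc _ = ∑ i, X i * ∑ j, y j * fundTensor L i j x y := by
          simp only [Finset.mul_sum]
          exact Finset.sum_congr rfl fun s _ => Finset.sum_congr rfl fun j _ => by ring
      _ = L x y * dirY X L x y := by
          simp only [hgy, dY_energy hD hL hp, dirY, Finset.mul_sum]
          exact Finset.sum_congr rfl fun s _ => by ring
      _ = 0 := by rw [hX, mul_zero]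
  have hyy : ∑ i, ∑ j, fundTensor L i j x y * y i * y j = L x y ^ 2 := by
    calc _ = ∑ i, y i * ∑ j, y j * fundTensor L i j x y := by
          simp only [Finset.mul_sum]
          exact Finset.sum_congr rfl fun s _ => Finset.sum_congr rfl fun j _ => by ring
      _ = L x y * ∑ j, y j * dY j L x y := by
          simp only [hgy, dY_energy hD hL hp, Finset.mul_sum]
          exact Finset.sum_congr rfl fun s _ => by ring
      _ = _ := by rw [hL1 x y hp]; ring
  have hnum : ∑ h, ∑ i, ∑ j, ∑ k, curvatureLow L h i j k x y * y h * X i * y j * X k =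
      lam * ∑ i, ∑ j, fundTensor L i j x y * X i * X j := by
    calc _ = ∑ i, ∑ k, ∑ r, fundTensor L i r x y * X i * X k *
          ∑ h, ∑ j, curvature L h r j k x y * y h * y j := by
          simp only [curvatureLow, Finset.mul_sum, Finset.sum_mul]
          rw [Finset.sum_comm]
          refine Finset.sum_congr rfl fun i _ => ?_
          rw [Finset.sum_congr rfl fun h _ => Finset.sum_comm, Finset.sum_comm]
          refine Finset.sum_congr rfl fun k _ => ?_
          rw [Finset.sum_congr rfl fun h _ => Finset.sum_comm, Finset.sum_comm]
          exact Finset.sum_congr rfl fun r _ => Finset.sum_congr rfl fun h _ =>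
            Finset.sum_congr rfl fun j _ => by ring
      _ = lam * (∑ i, ∑ j, fundTensor L i j x y * X i * X j) +
          (∑ i, ∑ j, fundTensor L i j x y * X i * y j) * ∑ k, τ k * X k := by
          rw [Finset.mul_sum, Finset.sum_mul, ← Finset.sum_add_distrib]
          refine Finset.sum_congr rfl fun i _ => ?_
          simp only [hτ, mul_add, Finset.sum_add_distrib]
          congr 1
          · simp only [mul_ite, mul_one, mul_zero, Finset.sum_ite_eq', Finset.mem_univ, if_true,
              Finset.mul_sum]
            exact Finset.sum_congr rfl fun k _ => by ring
          · rw [Finset.mul_sum]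
            refine Finset.sum_congr rfl fun k _ => ?_
            rw [Finset.sum_mul]
            exact Finset.sum_congr rfl fun k _ => by ring
      _ = _ := by rw [hXy, zero_mul, add_zero]
  have hden : ∑ h, ∑ i, ∑ j, ∑ k,
      (fundTensor L h j x y * fundTensor L i k x y - fundTensor L h k x y * fundTensor L i j x y) *
        y h * X i * y j * X k =
      L x y ^ 2 * ∑ i, ∑ j, fundTensor L i j x y * X i * X j := by
    calc _ = (∑ i, ∑ j, fundTensor L i j x y * y i * y j) *
            (∑ i, ∑ j, fundTensor L i j x y * X i * X j) -
          (∑ i, ∑ j, fundTensor L i j x y * y i * X j) *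
            ∑ i, ∑ j, fundTensor L i j x y * X i * y j := by
          rw [Finset.sum_mul_sum, Finset.sum_mul_sum, ← Finset.sum_sub_distrib]
          refine Finset.sum_congr rfl fun h _ => ?_
          rw [← Finset.sum_sub_distrib]
          refine Finset.sum_congr rfl fun i _ => ?_
          rw [Finset.sum_mul_sum, Finset.sum_mul_sum, Finset.sum_comm (s := Finset.univ)
            (f := fun k j => fundTensor L h k x y * y h * X k * (fundTensor L i j x y * X i * y j)),
            ← Finset.sum_sub_distrib]
          refine Finset.sum_congr rfl fun j _ => ?_
          rw [← Finset.sum_sub_distrib]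
          exact Finset.sum_congr rfl fun k _ => by ring
      _ = _ := by rw [hXy, hyy, mul_zero, sub_zero]
  have := (hL0 x y hp).ne'
  rw [flagCurvature, hnum, hden]
  field_simp

end Hamel

end KropinaSpace

/-! ### First variation of length along straight lines -/

namespace KropinaSpace

section Variation

/-- Differentiation of `∫ F(s, t) dt` over a compact interval in the parameter `s`, when `F` and
`∂F/∂s` are continuous on a neighbourhood of the segment of integration. -/
lemma hasDerivAt_intervalIntegral_of_isOpen {F F' : ℝ → ℝ → ℝ} {O : Set (ℝ × ℝ)} (hO : IsOpen O)
    {a b s₀ : ℝ} (hab : a ≤ b) (hsub : ∀ t ∈ Icc a b, (s₀, t) ∈ O)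
    (hF : ContinuousOn (fun p : ℝ × ℝ => F p.1 p.2) O)
    (hF' : ContinuousOn (fun p : ℝ × ℝ => F' p.1 p.2) O)
    (hd : ∀ s t, (s, t) ∈ O → HasDerivAt (fun s => F s t) (F' s t) s) :
    HasDerivAt (fun s => ∫ t in a..b, F s t) (∫ t in a..b, F' s₀ t) s₀ := by
  obtain ⟨u, v, hu, -, hsu, htv, huv⟩ := generalized_tube_lemma (isCompact_singleton (x := s₀))
    (isCompact_Icc (a := a) (b := b)) hO (by rintro ⟨s, t⟩ ⟨rfl, ht⟩; exact hsub t ht)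
  obtain ⟨ε, hε, hball⟩ := Metric.nhds_basis_closedBall.mem_iff.1
    (hu.mem_nhds (singleton_subset_iff.1 hsu))
  have hmem : ∀ s ∈ Metric.closedBall s₀ ε, ∀ t ∈ Icc a b, (s, t) ∈ O :=
    fun s hs t ht => huv ⟨hball hs, htv ht⟩
  obtain ⟨C, hC⟩ := ((isCompact_closedBall s₀ ε).prod (isCompact_Icc (a := a) (b := b))).bddAbove_image
    (hF'.mono fun p hp => hmem p.1 hp.1 p.2 hp.2).norm
  have hsubI : uIoc a b ⊆ Icc a b := by rw [uIoc_of_le hab]; exact Ioc_subset_Icc_self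
  have hc : ∀ {G : ℝ → ℝ → ℝ}, ContinuousOn (fun p : ℝ × ℝ => G p.1 p.2) O →
      ∀ s ∈ Metric.closedBall s₀ ε, ContinuousOn (G s) (Icc a b) := fun hG s hs =>
    hG.comp (Continuous.prodMk_right s).continuousOn fun t ht => hmem s hs t ht
  have hs₀ : s₀ ∈ Metric.closedBall s₀ ε := Metric.mem_closedBall_self hε.le
  refine (intervalIntegral.hasDerivAt_integral_of_dominated_loc_of_deriv_le
    (s := Metric.closedBall s₀ ε) (bound := fun _ => C)
    (Metric.closedBall_mem_nhds s₀ hε) ?_ ?_ ?_ ?_ ?_ ?_).2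
  · filter_upwards [Metric.closedBall_mem_nhds s₀ hε] with s hs
    exact ((hc hF s hs).mono hsubI).aestronglyMeasurable measurableSet_uIoc
  · exact (hc hF s₀ hs₀).intervalIntegrable_of_Icc hab
  · exact ((hc hF' s₀ hs₀).mono hsubI).aestronglyMeasurable measurableSet_uIoc
  · exact Filter.Eventually.of_forall fun t ht s hs =>
      hC (mem_image_of_mem (fun p : ℝ × ℝ => ‖F' p.1 p.2‖)
        (show (s, t) ∈ Metric.closedBall s₀ ε ×ˢ Icc a b from ⟨hs, hsubI ht⟩))
  · exact intervalIntegrable_const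
  · exact Filter.Eventually.of_forall fun t ht s hs => hd s t (hmem s hs t (hsubI ht))

variable {n : ℕ} {D : Set (EuclideanSpace ℝ (Fin n) × EuclideanSpace ℝ (Fin n))}
  {L : EuclideanSpace ℝ (Fin n) → EuclideanSpace ℝ (Fin n) → ℝ}
  {x y : EuclideanSpace ℝ (Fin n)}

lemma JointlySmoothOn.hasDerivAt_line {f : EuclideanSpace ℝ (Fin n) → EuclideanSpace ℝ (Fin n) → ℝ}
    (hf : JointlySmoothOn D f) (hD : IsOpen D) {t : ℝ} (hp : (x + t • y, y) ∈ D) :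
    HasDerivAt (fun t : ℝ => f (x + t • y) y) (KropinaSpace.lineDerivX f (x + t • y) y) t := by
  have h1 : HasDerivAt (fun t : ℝ => x + t • y) y t := by
    simpa using ((hasDerivAt_id t).smul_const y).const_add x
  have h2 := HasFDerivAt.comp_hasDerivAt (f := fun t : ℝ => x + t • y) t
    (hf.hasFDerivAt_fst hD hp) h1
  rw [hf.lineDerivX_eq hD hp]
  simpa [Function.comp_def] using h2

/-- First variation of length along a straight line, for variations in a coordinate direction. -/
lemma hasDerivAt_length_line (hD : IsOpen D) (hL : JointlySmoothOn D L) {a b : ℝ} (hab : a ≤ b)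
    (hline : ∀ t ∈ Icc a b, (x + t • y, y) ∈ D) {g : ℝ → ℝ} (hg : ContDiff ℝ ∞ g) (l : Fin n) :
    HasDerivAt (fun s : ℝ => ∫ t in a..b,
        L (x + t • y + s • g t • EuclideanSpace.single l (1 : ℝ))
          (y + s • deriv g t • EuclideanSpace.single l (1 : ℝ)))
      (∫ t in a..b, (g t * dX l L (x + t • y) y + deriv g t * dY l L (x + t • y) y)) 0 := by
  have hg' : Continuous (deriv g) := hg.continuous_deriv (by simp)
  have hgc : Continuous g := hg.continuous
  set e : EuclideanSpace ℝ (Fin n) := EuclideanSpace.single l (1 : ℝ) with he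
  set Lf := fun p : EuclideanSpace ℝ (Fin n) × EuclideanSpace ℝ (Fin n) => L p.1 p.2 with hLf
  set q : ℝ × ℝ → EuclideanSpace ℝ (Fin n) × EuclideanSpace ℝ (Fin n) := fun p =>
    (x + p.2 • y + p.1 • g p.2 • e, y + p.1 • deriv g p.2 • e) with hq
  have hqc : Continuous q := by fun_prop
  have hO : IsOpen (q ⁻¹' D) := hD.preimage hqc
  have hmaps : MapsTo q (q ⁻¹' D) D := mapsTo_preimage q D
  have hfd : ContinuousOn (fun p => fderiv ℝ Lf p) D :=
    (ContDiffOn.fderiv_of_isOpen hL hD (m := ∞) (by simp)).continuousOn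
  have hmain := hasDerivAt_intervalIntegral_of_isOpen (F := fun s t => Lf (q (s, t)))
    (F' := fun s t => fderiv ℝ Lf (q (s, t)) (g t • e, deriv g t • e)) (s₀ := 0) hO hab
    (fun t ht => by simpa [hq] using hline t ht)
    ((ContDiffOn.continuousOn hL).comp hqc.continuousOn hmaps)
    ((hfd.comp hqc.continuousOn hmaps).clm_apply (by fun_prop))
    (fun s t hst => by
      have h1 : HasDerivAt (fun s : ℝ => q (s, t)) (g t • e, deriv g t • e) s := by
        refine HasDerivAt.prodMk ?_ ?_
        · simpa using ((hasDerivAt_id s).smul_const (g t • e)).const_add (x + t • y)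
        · simpa using ((hasDerivAt_id s).smul_const (deriv g t • e)).const_add y
      exact (hL.hasFDerivAt hD (show ((q (s, t)).1, (q (s, t)).2) ∈ D from hst)).comp_hasDerivAt
        s h1)
  convert hmain using 1
  refine intervalIntegral.integral_congr fun t ht => ?_
  rw [uIcc_of_le hab] at ht
  have hp := hline t ht
  beta_reduce
  rw [hL.dX_eq hD hp, hL.dY_eq hD hp]
  have hq0 : q (0, t) = (x + t • y, y) := by simp [hq]
  have hsplit : (g t • e, deriv g t • e) =
      g t • ((e, 0) : EuclideanSpace ℝ (Fin n) × EuclideanSpace ℝ (Fin n)) +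
        deriv g t • ((0, e) : EuclideanSpace ℝ (Fin n) × EuclideanSpace ℝ (Fin n)) := by
    simp
  rw [hq0, hsplit, map_add, map_smul, map_smul, smul_eq_mul, smul_eq_mul]

/-- If straight lines are extremals, the Euler–Lagrange equations along them are Hamel's
equations. -/
lemma hamelOn_of_hasRectilinearExtremals (hD : IsOpen D) (hL : JointlySmoothOn D L)
    (hrect : HasRectilinearExtremals L D) : HamelOn D L := by
  intro l x y hp
  obtain ⟨δ, hδ, hline⟩ : ∃ δ : ℝ, 0 < δ ∧ ∀ t ∈ Icc (-δ) δ, (x + t • y, y) ∈ D := by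
    have hO : IsOpen {t : ℝ | (x + t • y, y) ∈ D} := hD.preimage (by fun_prop)
    obtain ⟨ε, hε, hball⟩ := Metric.nhds_basis_closedBall.mem_iff.1
      (hO.mem_nhds (show (0 : ℝ) ∈ _ by simpa using hp))
    refine ⟨ε, hε, fun t ht => hball ?_⟩
    simpa [abs_le] using ht
  have hab : -δ < δ := by linarith
  have hderiv : ∀ t, deriv (fun t : ℝ => x + t • y) t = y := fun t => by
    have h1 : HasDerivAt (fun t : ℝ => x + t • y) y t := by
      simpa using ((hasDerivAt_id t).smul_const y).const_add x
    exact h1.deriv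
  have hadm : IsAdmissible D (fun t : ℝ => x + t • y) (-δ) δ :=
    ⟨by fun_prop, fun t ht => by rw [hderiv]; exact hline t ht⟩
  have hext : IsExtremal L (fun t : ℝ => x + t • y) (-δ) δ := by
    refine (hrect _ _ _ hab hadm).2
      ((collinear_iff_exists_forall_eq_smul_vadd (k := ℝ) _).2 ⟨x, y, ?_⟩)
    rintro _ ⟨t, -, rfl⟩
    exact ⟨t, by simp [add_comm]⟩
  set h : ℝ → ℝ := fun t => dX l L (x + t • y) y - lineDerivX (dY l L) (x + t • y) y with hh
  have hcont : ∀ f, JointlySmoothOn D f →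
      ContinuousOn (fun t : ℝ => f (x + t • y) y) (Icc (-δ) δ) := fun f hf =>
    (ContDiffOn.continuousOn hf).comp (f := fun t : ℝ => (x + t • y, y))
      (by fun_prop) fun t ht => hline t ht
  have hcX := hcont _ (hL.dX hD l)
  have hcY := hcont _ (hL.dY hD l)
  have hcYX := hcont _ ((hL.dY hD l).lineDerivX hD)
  have hhc : ContinuousOn h (Icc (-δ) δ) := hcX.sub hcYX
  have hint : ∀ g : ℝ → ℝ, ContDiff ℝ ∞ g → HasCompactSupport g → tsupport g ⊆ Ioo (-δ) δ →
      ∫ t, g t • h t = 0 := by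
    intro g hg _ hsupp
    have hz : ∀ t, t ∉ Ioo (-δ) δ → g t = 0 := fun t ht =>
      image_eq_zero_of_notMem_tsupport fun hm => ht (hsupp hm)
    have hga : g (-δ) = 0 := hz _ (by simp)
    have hgb : g δ = 0 := hz _ (by simp)
    have hg' : Continuous (deriv g) := hg.continuous_deriv (by simp)
    have hgd : ∀ t, HasDerivAt g (deriv g t) t := fun t =>
      (hg.differentiable (by simp) t).hasDerivAt
    have hvar := hext (fun t => g t • EuclideanSpace.single l (1 : ℝ)) (by fun_prop)
      (by simp [hga]) (by simp [hgb])
    have hφ : ∀ t, deriv (fun t => g t • (EuclideanSpace.single l (1 : ℝ) :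
        EuclideanSpace ℝ (Fin n))) t = deriv g t • EuclideanSpace.single l (1 : ℝ) := fun t =>
      ((hgd t).smul_const _).deriv
    simp only [hderiv, hφ] at hvar
    have hzero := (hasDerivAt_length_line hD hL hab.le hline hg l).unique hvar
    have hi1 : IntervalIntegrable (fun t => g t * dX l L (x + t • y) y) volume (-δ) δ :=
      (hg.continuous.continuousOn.mul hcX).intervalIntegrable_of_Icc hab.le
    have hi2 : IntervalIntegrable (fun t => deriv g t * dY l L (x + t • y) y) volume (-δ) δ :=
      (hg'.continuousOn.mul hcY).intervalIntegrable_of_Icc hab.le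
    have hi3 : IntervalIntegrable (fun t => g t * lineDerivX (dY l L) (x + t • y) y) volume
        (-δ) δ := (hg.continuous.continuousOn.mul hcYX).intervalIntegrable_of_Icc hab.le
    have hparts := intervalIntegral.integral_mul_deriv_eq_deriv_mul (a := -δ) (b := δ)
      (u := g) (u' := deriv g) (v := fun t => dY l L (x + t • y) y)
      (v' := fun t => lineDerivX (dY l L) (x + t • y) y) (fun t _ => hgd t)
      (fun t ht => (hL.dY hD l).hasDerivAt_line hD
        (hline t (by rwa [uIcc_of_le hab.le] at ht)))
      (hg'.intervalIntegrable _ _) (hcYX.intervalIntegrable_of_Icc hab.le)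
    rw [intervalIntegral.integral_add hi1 hi2] at hzero
    rw [← intervalIntegral.integral_eq_integral_of_support_subset (a := -δ) (b := δ)]
    · simp only [hh, smul_eq_mul, mul_sub]
      rw [intervalIntegral.integral_sub hi1 hi3, hparts, hga, hgb]
      linarith
    · intro t ht
      by_contra hcon
      refine ht ?_
      simp [hz t fun hm => hcon ⟨hm.1, hm.2.le⟩]
  have hae := isOpen_Ioo.ae_eq_zero_of_integral_contDiff_smul_eq_zero
    ((hhc.mono Ioo_subset_Icc_self).locallyIntegrableOn measurableSet_Ioo) hint
  have heq : EqOn h (fun _ => 0) (Ioo (-δ) δ) :=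
    Measure.eqOn_open_of_ae_eq ((ae_restrict_iff' measurableSet_Ioo).2 hae) isOpen_Ioo
      (hhc.mono Ioo_subset_Icc_self) continuousOn_const
  have h0 := heq (show (0 : ℝ) ∈ Ioo (-δ) δ from ⟨by linarith, hδ⟩)
  simp only [hh, zero_smul, add_zero] at h0
  linarith

end Variation

end KropinaSpace

/-! ### Kropina metrics in coordinates -/

namespace KropinaSpace

section Kropina

variable {n : ℕ} {U : Set (EuclideanSpace ℝ (Fin n))}
  {Q : EuclideanSpace ℝ (Fin n) → EuclideanSpace ℝ (Fin n) →L[ℝ] EuclideanSpace ℝ (Fin n) →L[ℝ] ℝ}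
  {β : EuclideanSpace ℝ (Fin n) → EuclideanSpace ℝ (Fin n) →L[ℝ] ℝ}
  {x y v X : EuclideanSpace ℝ (Fin n)}

/-- The field `Q` of bilinear forms and the field `β` of linear forms, over the open set `U`, are
the coordinate expressions of a smooth Riemannian metric and of a smooth `1`-form. -/
structure IsKropinaPair (U : Set (EuclideanSpace ℝ (Fin n)))
    (Q : EuclideanSpace ℝ (Fin n) →
      EuclideanSpace ℝ (Fin n) →L[ℝ] EuclideanSpace ℝ (Fin n) →L[ℝ] ℝ)
    (β : EuclideanSpace ℝ (Fin n) → EuclideanSpace ℝ (Fin n) →L[ℝ] ℝ) : Prop where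
  isOpen : IsOpen U
  smooth_quad : JointlySmoothOn (U ×ˢ univ) (fun x y => Q x y y)
  smooth_form : JointlySmoothOn (U ×ˢ univ) (fun x y => β x y)
  symm : ∀ x ∈ U, ∀ v w, Q x v w = Q x w v
  pos : ∀ x ∈ U, ∀ v, v ≠ 0 → 0 < Q x v v

/-- The Kropina metric `Q(y, y) / β(y)`. -/
def kropina (Q : EuclideanSpace ℝ (Fin n) →
      EuclideanSpace ℝ (Fin n) →L[ℝ] EuclideanSpace ℝ (Fin n) →L[ℝ] ℝ)
    (β : EuclideanSpace ℝ (Fin n) → EuclideanSpace ℝ (Fin n) →L[ℝ] ℝ) :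
    EuclideanSpace ℝ (Fin n) → EuclideanSpace ℝ (Fin n) → ℝ :=
  fun x y => Q x y y / β x y

/-- The conic domain `β > 0` over `U`. -/
def kropinaDomain (U : Set (EuclideanSpace ℝ (Fin n)))
    (β : EuclideanSpace ℝ (Fin n) → EuclideanSpace ℝ (Fin n) →L[ℝ] ℝ) :
    Set (EuclideanSpace ℝ (Fin n) × EuclideanSpace ℝ (Fin n)) :=
  {p | p.1 ∈ U ∧ 0 < β p.1 p.2}

lemma kropinaDomain_subset : kropinaDomain U β ⊆ U ×ˢ univ := fun _ hp => ⟨hp.1, trivial⟩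

lemma kropina_mul (Q : EuclideanSpace ℝ (Fin n) →
    EuclideanSpace ℝ (Fin n) →L[ℝ] EuclideanSpace ℝ (Fin n) →L[ℝ] ℝ) (hp : (x, y) ∈ kropinaDomain U β) :
    kropina Q β x y * β x y = Q x y y :=
  div_mul_cancel₀ _ hp.2.ne'

lemma dirY_quad (hsymm : ∀ v w, Q x v w = Q x w v) :
    dirY v (fun x y => Q x y y) x y = 2 * Q x y v := by
  rw [dirY_eq_fderiv]
  have h := (Q x).hasFDerivAt_of_bilinear (hasFDerivAt_id y) (hasFDerivAt_id y)
  simp only [id] at h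
  rw [h.fderiv]
  simp [hsymm v y]
  ring

lemma dirY_form : dirY v (fun x y => β x y) x y = β x v := by
  rw [dirY_eq_fderiv]
  simp

lemma dirY_const_snd (h : EuclideanSpace ℝ (Fin n) → ℝ) :
    dirY v (fun x _ => h x) x y = 0 := by
  rw [dirY_eq_fderiv]
  simp

namespace IsKropinaPair

variable (h : IsKropinaPair U Q β)
include h

lemma isOpen_prod : IsOpen (U ×ˢ (univ : Set (EuclideanSpace ℝ (Fin n)))) :=
  h.isOpen.prod isOpen_univ

lemma isOpen_domain : IsOpen (kropinaDomain U β) := by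
  have : kropinaDomain U β = (U ×ˢ univ) ∩
      (fun p : EuclideanSpace ℝ (Fin n) × EuclideanSpace ℝ (Fin n) => β p.1 p.2) ⁻¹' Ioi 0 := by
    ext p
    simp [kropinaDomain]
  rw [this]
  exact h.smooth_form.continuousOn.isOpen_inter_preimage h.isOpen_prod isOpen_Ioi

lemma kropina_pos (hp : (x, y) ∈ kropinaDomain U β) : 0 < kropina Q β x y := by
  refine div_pos (h.pos x hp.1 y ?_) hp.2
  rintro rfl
  simpa using hp.2

lemma jointlySmoothOn_kropina : JointlySmoothOn (kropinaDomain U β) (kropina Q β) :=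
  ContDiffOn.div (h.smooth_quad.mono kropinaDomain_subset)
    (h.smooth_form.mono kropinaDomain_subset) fun _ hp => hp.2.ne'

lemma dirY_kropina (hp : (x, y) ∈ kropinaDomain U β) :
    dirY v (kropina Q β) x y * β x y + kropina Q β x y * β x v = 2 * Q x y v := by
  have hc := dirY_congr h.isOpen_domain (fun x y hp => kropina_mul Q hp) hp v
  rw [dirY_mul h.isOpen_domain h.jointlySmoothOn_kropina
    (h.smooth_form.mono kropinaDomain_subset) hp, dirY_quad (h.symm x hp.1), dirY_form] at hc
  exact hc

lemma isHomogeneousOn_kropina : IsHomogeneousOn (kropinaDomain U β) 1 (kropina Q β) := by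
  intro x y hp
  have h1 := h.dirY_kropina hp (v := y)
  rw [← kropina_mul Q hp] at h1
  apply mul_right_cancel₀ hp.2.ne'
  change dirY y (kropina Q β) x y * _ = _
  linarith

lemma dirY_dirY_kropina (hp : (x, y) ∈ kropinaDomain U β) :
    dirY v (dirY v (kropina Q β)) x y * β x y + 2 * dirY v (kropina Q β) x y * β x v =
      2 * Q x v v := by
  have hO := h.isOpen_domain
  have hL := h.jointlySmoothOn_kropina
  have hβ := h.smooth_form.mono (kropinaDomain_subset (β := β))
  have hβv : JointlySmoothOn (kropinaDomain U β) (fun x _ => β x v) :=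
    (hβ.dirY hO v).congr fun _ _ _ => dirY_form
  have hQ := h.smooth_quad.mono (kropinaDomain_subset (β := β))
  have hQv : JointlySmoothOn (kropinaDomain U β) (fun x y => 2 * Q x y v) :=
    (hQ.dirY hO v).congr fun _ _ hp => dirY_quad (h.symm _ hp.1)
  have hc := dirY_congr hO (fun x y hp => h.dirY_kropina (v := v) hp) hp v
  rw [dirY_add hO ((hL.dirY hO v).mul hβ) (hL.mul hβv) hp, dirY_mul hO (hL.dirY hO v) hβ hp,
    dirY_mul hO hL hβv hp, dirY_form, dirY_const_snd (fun x => β x v)] at hc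
  have h2 : dirY v (fun x y => 2 * Q x y v) x y = 2 * Q x v v := by
    rw [dirY_eq_fderiv]
    have h3 : HasFDerivAt (fun y' => 2 * Q x y' v) ((2 : ℝ) • (Q x).flip v) y :=
      ((Q x).flip v).hasFDerivAt.const_mul 2
    rw [h3.fderiv]
    simp
  rw [h2] at hc
  linarith

/-- The fundamental tensor of a Kropina metric is positive definite. -/
lemma fundTensor_pos (hp : (x, y) ∈ kropinaDomain U β) (hv : v ≠ 0) :
    0 < ∑ i, ∑ j, fundTensor (kropina Q β) i j x y * v i * v j := by
  have hO := h.isOpen_domain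
  have hL := h.jointlySmoothOn_kropina
  have hE := jointlySmoothOn_energy hL
  have hL0 := h.kropina_pos hp
  have hB : 0 < β x y := hp.2
  have h1 := h.dirY_kropina (v := v) hp
  have h2 := h.dirY_dirY_kropina (v := v) hp
  have hq := kropina_mul Q hp
  have hg : ∑ i, ∑ j, fundTensor (kropina Q β) i j x y * v i * v j =
      dirY v (kropina Q β) x y ^ 2 +
        kropina Q β x y * dirY v (dirY v (kropina Q β)) x y := by
    have hdE : ∀ x y, (x, y) ∈ kropinaDomain U β →
        dirY v (fun x y => kropina Q β x y ^ 2 / 2) x y =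
          kropina Q β x y * dirY v (kropina Q β) x y := by
      intro x y hp
      simp only [dirY, dY_energy hO hL hp, Finset.mul_sum]
      exact Finset.sum_congr rfl fun _ _ => by ring
    have hd := dirY_congr hO hdE hp v
    rw [dirY_mul hO hL (hL.dirY hO v) hp] at hd
    rw [sq, ← hd]
    change _ = ∑ i, v i * dY i (fun x y => ∑ j, v j *
      dY j (fun x y => kropina Q β x y ^ 2 / 2) x y) x y
    simp only [fundTensor]
    refine Finset.sum_congr rfl fun i _ => ?_
    rw [dY_sum hO (fun j _ => (jointlySmoothOn_const (v j)).mul (hE.dY hO j)) hp, Finset.mul_sum]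
    exact Finset.sum_congr rfl fun j _ => by rw [dY_const_mul hO (hE.dY hO j) hp]; ring
  -- The Hessian in `y` of the metric itself, in the direction `v`, is `2 Q(u, u) / β(y)`.
  set u := v - (β x v / β x y) • y with hu
  have hQu : Q x u u = Q x v v - β x v * dirY v (kropina Q β) x y := by
    have : dirY v (kropina Q β) x y = (2 * Q x y v - kropina Q β x y * β x v) / β x y := by
      field_simp
      linarith
    rw [this, hu]
    simp only [map_sub, map_smul, sub_apply, smul_apply, smul_eq_mul]
    rw [h.symm x hp.1 v y, ← hq]
    field_simp
    ring
  have hgB : (∑ i, ∑ j, fundTensor (kropina Q β) i j x y * v i * v j) * β x y =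
      dirY v (kropina Q β) x y ^ 2 * β x y + 2 * kropina Q β x y * Q x u u := by
    rw [hg, hQu]
    linear_combination kropina Q β x y * h2
  refine pos_of_mul_pos_left ?_ hB.le
  rw [hgB]
  rcases eq_or_ne u 0 with hu0 | hu0
  · have hvy : v = (β x v / β x y) • y := sub_eq_zero.1 hu0
    have hl : dirY v (kropina Q β) x y ≠ 0 := by
      intro hl
      rw [hl, zero_mul, zero_add, h.symm x hp.1 y v] at h1
      have hne : β x v ≠ 0 := by
        intro h0
        rw [h0, zero_div, zero_smul] at hvy
        exact hv hvy
      have h3 : Q x v y = β x v * kropina Q β x y := by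
        rw [hvy]
        simp only [map_smul, smul_apply, smul_eq_mul, ← hq]
        field_simp
      rw [h3] at h1
      have : β x v * kropina Q β x y = 0 := by linarith
      exact (mul_ne_zero hne hL0.ne') this
    rw [hu0]
    have : 0 < dirY v (kropina Q β) x y ^ 2 := by positivity
    simp
    positivity
  · have := h.pos x hp.1 u hu0
    positivity

lemma isUnit_det_fundTensor (hp : (x, y) ∈ kropinaDomain U β) :
    IsUnit (Matrix.of fun p q => fundTensor (kropina Q β) p q x y).det := by
  rw [isUnit_iff_ne_zero]
  intro h0
  obtain ⟨v, hv, hMv⟩ := Matrix.exists_mulVec_eq_zero_iff.2 h0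
  have hpos := h.fundTensor_pos hp (v := WithLp.toLp 2 v)
    (by simpa using hv)
  have : ∑ i, ∑ j, fundTensor (kropina Q β) i j x y * v i * v j = 0 := by
    calc _ = ∑ i, v i * (Matrix.of fun p q => fundTensor (kropina Q β) p q x y).mulVec v i := by
          simp only [Matrix.mulVec, dotProduct, Matrix.of_apply, Finset.mul_sum]
          exact Finset.sum_congr rfl fun i _ => Finset.sum_congr rfl fun j _ => by ring
      _ = 0 := by simp [hMv]
  exact hpos.ne' this

/-- Constant flag curvature `K` of a Kropina metric with rectilinear extremals, as a polynomial
identity in `y`; the derivatives are taken along straight lines. -/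
lemma flagCurvature_identity (hH : HamelOn (kropinaDomain U β) (kropina Q β))
    (hp : (x, y) ∈ kropinaDomain U β) (hX : dirY X (kropina Q β) x y = 0) (hX0 : X ≠ 0) :
    3 * (lineDerivX (fun x y => Q x y y) x y * β x y -
        Q x y y * lineDerivX (fun x y => β x y) x y) ^ 2 -
      2 * Q x y y * (lineDerivX (lineDerivX (fun x y => Q x y y)) x y * β x y ^ 2 -
        2 * lineDerivX (fun x y => Q x y y) x y * β x y * lineDerivX (fun x y => β x y) x y +
        2 * Q x y y * lineDerivX (fun x y => β x y) x y ^ 2 -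
        Q x y y * β x y * lineDerivX (lineDerivX (fun x y => β x y)) x y) =
      4 * flagCurvature (kropina Q β) x y X * Q x y y ^ 4 := by
  have hO := h.isOpen_domain
  have hL := h.jointlySmoothOn_kropina
  have hβ := h.smooth_form.mono (kropinaDomain_subset (β := β))
  have hL0 : ∀ x y, (x, y) ∈ kropinaDomain U β → 0 < kropina Q β x y :=
    fun _ _ hp => h.kropina_pos hp
  have hP := jointlySmoothOn_projFactor hO hL hL0
  have hK := flagCurvature_mul_sq hO hL hL0 h.isHomogeneousOn_kropina hH
    (fun _ _ hp => h.isUnit_det_fundTensor hp) hp hX (h.fundTensor_pos hp hX0).ne'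
  have e0 := kropina_mul Q hp
  have c1 : ∀ x y, (x, y) ∈ kropinaDomain U β → _ := fun x y hp =>
    (lineDerivX_mul hO hL hβ hp).symm.trans
      (lineDerivX_congr hO (fun x y hp => kropina_mul Q hp) hp)
  have e1 := c1 x y hp
  have e2 := lineDerivX_congr hO c1 hp
  rw [lineDerivX_add hO ((hL.lineDerivX hO).mul hβ) (hL.mul (hβ.lineDerivX hO)) hp,
    lineDerivX_mul hO (hL.lineDerivX hO) hβ hp, lineDerivX_mul hO hL (hβ.lineDerivX hO) hp] at e2
  have f1 := two_mul_mul_projFactor hL0 hp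
  have f2 := lineDerivX_congr hO (fun x y hp => two_mul_mul_projFactor hL0 hp) hp
  rw [lineDerivX_mul hO ((jointlySmoothOn_const 2).mul hL) hP hp,
    lineDerivX_mul hO (jointlySmoothOn_const 2) hL hp] at f2
  have f0 : lineDerivX (fun _ _ => (2 : ℝ)) x y = 0 := by simp [lineDerivX]
  rw [f0, zero_mul, zero_add] at f2
  rw [← e0, ← e1, ← e2]
  have h3 : 3 * lineDerivX (kropina Q β) x y ^ 2 -
      2 * kropina Q β x y * lineDerivX (lineDerivX (kropina Q β)) x y =
      4 * flagCurvature (kropina Q β) x y X * kropina Q β x y ^ 4 := by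
    rw [← f2, ← f1]
    linear_combination -4 * kropina Q β x y ^ 2 * hK
  linear_combination β x y ^ 4 * h3

/-- A Kropina metric with rectilinear extremals has no constant positive flag curvature: at the
boundary `β = 0` of the conic domain, the curvature identity becomes
`-(∂β/∂xᵏ yᵏ)² = 4 K Q(y, y)²`. -/
lemma false_of_flagCurvature_eq (hH : HamelOn (kropinaDomain U β) (kropina Q β)) (hn : 2 ≤ n)
    (hx : x ∈ U) (hβ : β x ≠ 0) {K : ℝ} (hK : 0 < K)
    (hcurv : ∀ y X, (x, y) ∈ kropinaDomain U β → (x, X) ∈ kropinaDomain U β →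
      LinearIndependent ℝ ![y, X] → flagCurvature (kropina Q β) x y X = K) : False := by
  have hO := h.isOpen_prod
  obtain ⟨y₀, hy₀, hy₀0⟩ : ∃ y₀, β x y₀ = 0 ∧ y₀ ≠ 0 := by
    have hker : (β x).toLinearMap.ker ≠ ⊥ :=
      LinearMap.ker_ne_bot_of_finrank_lt (by simp; omega)
    obtain ⟨y₀, hm, h0⟩ := Submodule.exists_mem_ne_zero_of_ne_bot hker
    exact ⟨y₀, hm, h0⟩
  have hA₀ : 0 < Q x y₀ y₀ := h.pos x hx y₀ hy₀0
  obtain ⟨W, hW, hy₀W⟩ : ∃ W, 0 < β x W ∧ Q x y₀ W = 0 := by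
    obtain ⟨W₁, hW₁⟩ : ∃ W₁, 0 < β x W₁ := by
      obtain ⟨w, hw⟩ := DFunLike.ne_iff.1 hβ
      rcases lt_or_gt_of_ne hw with hlt | hgt
      · exact ⟨-w, by simpa using hlt⟩
      · exact ⟨w, by simpa using hgt⟩
    refine ⟨W₁ - (Q x y₀ W₁ / Q x y₀ y₀) • y₀, by simpa [hy₀] using hW₁, ?_⟩
    simp only [map_sub, map_smul, smul_eq_mul]
    field_simp
    ring
  set Φ : EuclideanSpace ℝ (Fin n) → ℝ := fun y =>
    3 * (lineDerivX (fun x y => Q x y y) x y * β x y -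
        Q x y y * lineDerivX (fun x y => β x y) x y) ^ 2 -
      2 * Q x y y * (lineDerivX (lineDerivX (fun x y => Q x y y)) x y * β x y ^ 2 -
        2 * lineDerivX (fun x y => Q x y y) x y * β x y * lineDerivX (fun x y => β x y) x y +
        2 * Q x y y * lineDerivX (fun x y => β x y) x y ^ 2 -
        Q x y y * β x y * lineDerivX (lineDerivX (fun x y => β x y)) x y) -
      4 * K * Q x y y ^ 4 with hΦ
  have hcont : Continuous Φ := by
    have hc : ∀ f, JointlySmoothOn (U ×ˢ univ) f → Continuous fun y => f x y := fun f hf =>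
      (ContDiffOn.continuousOn hf).comp_continuous (Continuous.prodMk_right x) fun y => ⟨hx, trivial⟩
    have c1 := hc _ h.smooth_quad
    have c2 := hc _ h.smooth_form
    have c3 := hc _ (h.smooth_quad.lineDerivX hO)
    have c4 := hc _ (h.smooth_form.lineDerivX hO)
    have c5 := hc _ ((h.smooth_quad.lineDerivX hO).lineDerivX hO)
    have c6 := hc _ ((h.smooth_form.lineDerivX hO).lineDerivX hO)
    fun_prop
  have hzero : ∀ ε : ℝ, 0 < ε → Φ (y₀ + ε • W) = 0 := by
    intro ε hε
    set y := y₀ + ε • W with hy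
    -- In the plane of `y₀` and `W`, this vector spans the tangent line at `y` of the level curve
    -- of the metric.
    set X := (Q x y₀ y₀ - ε ^ 2 * Q x W W) • y₀ + (2 * ε * Q x y₀ y₀) • W with hXdef
    have hWy₀ : Q x W y₀ = 0 := by rw [h.symm x hx, hy₀W]
    have hβy : β x y = ε * β x W := by simp [hy, hy₀]
    have hβX : β x X = 2 * ε * Q x y₀ y₀ * β x W := by simp [hXdef, hy₀]
    have hyy : Q x y y = Q x y₀ y₀ + ε ^ 2 * Q x W W := by
      simp [hy, hy₀W, hWy₀]
      ring
    have hyX : Q x y X =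
        (Q x y₀ y₀ - ε ^ 2 * Q x W W) * Q x y₀ y₀ + ε * (2 * ε * Q x y₀ y₀) * Q x W W := by
      simp [hy, hXdef, hy₀W, hWy₀]
      ring
    have hp : (x, y) ∈ kropinaDomain U β := ⟨hx, by simp only [hβy]; positivity⟩
    have hpX : (x, X) ∈ kropinaDomain U β := ⟨hx, by simp only [hβX]; positivity⟩
    have hX0 : X ≠ 0 := by
      intro h0
      have := hpX.2
      simp [h0] at this
    have hdX : dirY X (kropina Q β) x y = 0 := by
      have h1 := h.dirY_kropina (v := X) hp
      have h2 := kropina_mul Q hp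
      have hne := hp.2.ne'
      have h3 : dirY X (kropina Q β) x y * (β x y) ^ 2 = 0 := by
        have : dirY X (kropina Q β) x y * (β x y) ^ 2 =
            2 * Q x y X * β x y - Q x y y * β x X := by
          rw [← h2]
          linear_combination β x y * h1
        rw [this, hyX, hyy, hβX, hβy]
        ring
      simpa [hne] using h3
    have hlin : LinearIndependent ℝ ![y, X] := by
      rw [LinearIndependent.pair_iff]
      intro s t hst
      have hs : s = 0 := by
        have hd := congrArg (fderiv ℝ (fun y' => kropina Q β x y') y) hst
        have hdy := h.isHomogeneousOn_kropina x y hp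
        change dirY y (kropina Q β) x y = _ at hdy
        simp only [map_add, map_smul, smul_eq_mul, map_zero] at hd
        rw [← dirY_eq_fderiv, ← dirY_eq_fderiv, hdX, hdy] at hd
        have := (h.kropina_pos hp).ne'
        simpa [this] using hd
      rw [hs, zero_smul, zero_add] at hst
      exact ⟨hs, (smul_eq_zero.1 hst).resolve_right hX0⟩
    have hpoly := h.flagCurvature_identity hH hp hdX hX0
    rw [hcurv y X hp hpX hlin] at hpoly
    simp only [hΦ]
    linarith
  have hΦ0 : Φ y₀ = 0 := by
    have hcl : IsClosed {ε : ℝ | Φ (y₀ + ε • W) = 0} :=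
      isClosed_eq (by fun_prop) continuous_const
    have hsub : Ioi (0 : ℝ) ⊆ {ε : ℝ | Φ (y₀ + ε • W) = 0} := fun ε hε => hzero ε hε
    have hmem : (0 : ℝ) ∈ closure (Ioi (0 : ℝ)) := by
      rw [closure_Ioi]
      exact self_mem_Ici
    have h0 := closure_minimal hsub hcl hmem
    rw [mem_ofPred_eq] at h0
    simpa using h0
  simp only [hΦ, hy₀] at hΦ0
  have hpos : 0 < 4 * K * Q x y₀ y₀ ^ 4 := by positivity
  nlinarith [sq_nonneg (Q x y₀ y₀ * lineDerivX (fun x y => β x y) x y₀)]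

end IsKropinaPair

end Kropina

end KropinaSpace

/-! ### Kropina data in a chart -/

namespace KropinaSpace

namespace KropinaData

variable {n : ℕ} {M : Type*} [TopologicalSpace M] [ChartedSpace (EuclideanSpace ℝ (Fin n)) M]
  [IsManifold (𝓡 n) ∞ M]

/-- The Riemannian metric of `κ` in the chart `e`.  Tangent spaces carry no norm, which
`bilinearComp` asks for; they are replaced by the model space, to which they are definitionally
equal. -/
def quadInChart (κ : KropinaData n M) (e : OpenPartialHomeomorph M (EuclideanSpace ℝ (Fin n)))
    (x : EuclideanSpace ℝ (Fin n)) :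
    EuclideanSpace ℝ (Fin n) →L[ℝ] EuclideanSpace ℝ (Fin n) →L[ℝ] ℝ :=
  let B : EuclideanSpace ℝ (Fin n) →L[ℝ] EuclideanSpace ℝ (Fin n) →L[ℝ] ℝ :=
    κ.a.inner (e.symm x)
  let T : EuclideanSpace ℝ (Fin n) →L[ℝ] EuclideanSpace ℝ (Fin n) :=
    mfderiv 𝓘(ℝ, EuclideanSpace ℝ (Fin n)) (𝓡 n) e.symm x
  B.bilinearComp T T

/-- The `1`-form of `κ` in the chart `e`. -/
def formInChart (κ : KropinaData n M) (e : OpenPartialHomeomorph M (EuclideanSpace ℝ (Fin n)))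
    (x : EuclideanSpace ℝ (Fin n)) : EuclideanSpace ℝ (Fin n) →L[ℝ] ℝ :=
  (κ.b (e.symm x)).comp (mfderiv 𝓘(ℝ, EuclideanSpace ℝ (Fin n)) (𝓡 n) e.symm x)

lemma quadInChart_apply (κ : KropinaData n M)
    (e : OpenPartialHomeomorph M (EuclideanSpace ℝ (Fin n))) (x v w : EuclideanSpace ℝ (Fin n)) :
    κ.quadInChart e x v w = κ.a.inner (e.symm x)
      (mfderiv 𝓘(ℝ, EuclideanSpace ℝ (Fin n)) (𝓡 n) e.symm x v)
      (mfderiv 𝓘(ℝ, EuclideanSpace ℝ (Fin n)) (𝓡 n) e.symm x w) := rfl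

lemma inChart_metric (κ : KropinaData n M)
    (e : OpenPartialHomeomorph M (EuclideanSpace ℝ (Fin n))) :
    inChart κ.metric e = kropina (κ.quadInChart e) (κ.formInChart e) := rfl

lemma domainInChart_domain (κ : KropinaData n M)
    (e : OpenPartialHomeomorph M (EuclideanSpace ℝ (Fin n))) :
    domainInChart κ.domain e = kropinaDomain e.target (κ.formInChart e) := rfl

/-- The square norm of a Riemannian metric is smooth on the tangent bundle. -/
lemma contMDiff_quad (κ : KropinaData n M) :
    ContMDiff (𝓡 n).tangent 𝓘(ℝ, ℝ) ∞
      (fun v : TangentBundle (𝓡 n) M => κ.a.inner v.proj v.snd v.snd) := by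
  have hid : ContMDiff (𝓡 n).tangent (𝓡 n).tangent ∞
      (fun v : TangentBundle (𝓡 n) M =>
        (Bundle.TotalSpace.mk' (EuclideanSpace ℝ (Fin n)) v.proj v.snd :
          TangentBundle (𝓡 n) M)) := contMDiff_id
  have : ContMDiff (𝓡 n).tangent ((𝓡 n).prod 𝓘(ℝ, ℝ)) ∞
      (fun v : TangentBundle (𝓡 n) M => Bundle.TotalSpace.mk' ℝ (E := Bundle.Trivial M ℝ) v.proj
        (κ.a.inner v.proj v.snd v.snd)) := by
    apply ContMDiff.clm_bundle_apply₂ (F₁ := EuclideanSpace ℝ (Fin n))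
      (F₂ := EuclideanSpace ℝ (Fin n))
    · exact κ.a.contMDiff.comp (Bundle.contMDiff_proj _)
    · exact hid
    · exact hid
  intro v
  exact (Bundle.contMDiffAt_totalSpace.1 (this v)).2

/-- The coordinate expression of a smooth function on the tangent bundle is smooth. -/
lemma jointlySmoothOn_inChart {e : OpenPartialHomeomorph M (EuclideanSpace ℝ (Fin n))}
    (he : e ∈ IsManifold.maximalAtlas (𝓡 n) ∞ M) {f : TangentBundle (𝓡 n) M → ℝ}
    (hf : ContMDiff (𝓡 n).tangent 𝓘(ℝ, ℝ) ∞ f) :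
    JointlySmoothOn (e.target ×ˢ univ) (inChart f e) := by
  have h1 : ContMDiffOn 𝓘(ℝ, EuclideanSpace ℝ (Fin n)) (𝓡 n) ∞ e.symm e.target :=
    contMDiffOn_symm_of_mem_maximalAtlas he
  have h2 := h1.contMDiffOn_tangentMapWithin (m := ∞) (by simp) e.open_target.uniqueMDiffOn
  have h3 : ContMDiff (𝓘(ℝ, EuclideanSpace ℝ (Fin n) × EuclideanSpace ℝ (Fin n)))
      𝓘(ℝ, EuclideanSpace ℝ (Fin n)).tangent ∞
      (fun p : EuclideanSpace ℝ (Fin n) × EuclideanSpace ℝ (Fin n) =>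
        (⟨p.1, p.2⟩ : TangentBundle 𝓘(ℝ, EuclideanSpace ℝ (Fin n)) (EuclideanSpace ℝ (Fin n)))) := by
    intro p
    refine Bundle.contMDiffAt_totalSpace.2 ⟨contDiffAt_fst.contMDiffAt, ?_⟩
    simpa using contDiffAt_snd.contMDiffAt
  have h4 := hf.comp_contMDiffOn (h2.comp h3.contMDiffOn (s := e.target ×ˢ univ)
    fun p hp => hp.1)
  refine ContMDiffOn.contDiffOn (h4.congr ?_)
  rintro ⟨x, y⟩ hp
  simp only [Function.comp, inChart]
  rw [tangentMapWithin_eq_tangentMap (e.open_target.uniqueMDiffOn _ hp.1)]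
  exact (h1.mdifferentiableOn (by simp)).mdifferentiableAt (e.open_target.mem_nhds hp.1)

omit [IsManifold (𝓡 n) ∞ M] in
lemma mdifferentiable_of_mem_maximalAtlas {e : OpenPartialHomeomorph M (EuclideanSpace ℝ (Fin n))}
    (he : e ∈ IsManifold.maximalAtlas (𝓡 n) ∞ M) :
    e.symm.MDifferentiable 𝓘(ℝ, EuclideanSpace ℝ (Fin n)) (𝓡 n) :=
  ⟨(contMDiffOn_symm_of_mem_maximalAtlas he).mdifferentiableOn (by simp),
    (contMDiffOn_of_mem_maximalAtlas he).mdifferentiableOn (by simp)⟩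

lemma isKropinaPair (κ : KropinaData n M)
    {e : OpenPartialHomeomorph M (EuclideanSpace ℝ (Fin n))}
    (he : e ∈ IsManifold.maximalAtlas (𝓡 n) ∞ M) :
    IsKropinaPair e.target (κ.quadInChart e) (κ.formInChart e) := by
  refine ⟨e.open_target, ?_, ?_, fun x _ v w => ?_, fun x hx v hv => ?_⟩
  · exact (jointlySmoothOn_inChart he κ.contMDiff_quad).congr fun _ _ _ => rfl
  · exact (jointlySmoothOn_inChart he κ.smooth_b).congr fun _ _ _ => rfl
  · rw [quadInChart_apply, quadInChart_apply, κ.a.symm]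
  · have hinj := (mdifferentiable_of_mem_maximalAtlas he).mfderiv_injective hx
    have hne : mfderiv 𝓘(ℝ, EuclideanSpace ℝ (Fin n)) (𝓡 n) e.symm x v ≠ 0 := fun h0 =>
      hv (hinj (h0.trans (ContinuousLinearMap.map_zero _).symm))
    rw [quadInChart_apply]
    exact κ.a.pos _ _ hne

lemma formInChart_ne_zero (κ : KropinaData n M)
    {e : OpenPartialHomeomorph M (EuclideanSpace ℝ (Fin n))}
    (he : e ∈ IsManifold.maximalAtlas (𝓡 n) ∞ M) {x : EuclideanSpace ℝ (Fin n)}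
    (hx : x ∈ e.target) : κ.formInChart e x ≠ 0 := by
  intro h0
  refine κ.b_ne_zero (e.symm x) (ContinuousLinearMap.ext fun w => ?_)
  obtain ⟨v, rfl⟩ := (mdifferentiable_of_mem_maximalAtlas he).mfderiv_surjective hx w
  exact DFunLike.congr_fun h0 v

theorem not_isProjectivelyFlat [Nonempty M] (hn : 2 ≤ n) (κ : KropinaData n M) {K : ℝ}
    (hK : 0 < K) (hcurv : HasConstantFlagCurvature κ.domain κ.metric K) :
    ¬ IsProjectivelyFlat κ.domain κ.metric := by
  intro hflat
  obtain ⟨p⟩ := ‹Nonempty M›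
  obtain ⟨e, he, hp, hrect⟩ := hflat p
  have hcurv := hcurv e he (e p)
  rw [κ.inChart_metric, κ.domainInChart_domain] at hrect hcurv
  have hpair := κ.isKropinaPair he
  have hx := e.map_source hp
  refine hpair.false_of_flagCurvature_eq (hamelOn_of_hasRectilinearExtremals hpair.isOpen_domain
    hpair.jointlySmoothOn_kropina hrect) hn hx (κ.formInChart_ne_zero he hx) hK hcurv

end KropinaData

end KropinaSpace

end

theorem theorem7p12 (m : ℕ) (hm : 2 ≤ m)
    (κ : KropinaSpace.KropinaData (2 * m - 1)
      (Metric.sphere (0 : EuclideanSpace ℝ (Fin (2 * m - 1 + 1))) 1))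
    (K : ℝ) (hK : 0 < K)
    (hcurv : KropinaSpace.HasConstantFlagCurvature κ.domain κ.metric K) :
    ¬ KropinaSpace.IsProjectivelyFlat κ.domain κ.metric := by
  have : Nonempty (Metric.sphere (0 : EuclideanSpace ℝ (Fin (2 * m - 1 + 1))) 1) :=
    (NormedSpace.sphere_nonempty.2 zero_le_one).to_subtype
  exact κ.not_isProjectivelyFlat (by omega) hK hcurv
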